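/- **Local-SGD.** Let $F:\mathbb R^d\to\mathbb R$ be differentiable with minimiser $w^\star$. There are $P\ge1$ machines, $C\ge1$ phases, phase lengths $N^1,\dots,N^C\ge1$, a constant step size $\eta>0$ and a starting point $w_0\in\mathbb R^d$. Put $\hat w^0=w_0$. In phase $t\in\{1,\dots,C\}$ every machine $p\in\{1,\dots,P\}$ starts from $w_{p,0}^t=\hat w^{t-1}$ and makes $N^t$ local steps $$w_{p,k}^t=w_{p,k-1}^t-\eta\,g_{p,k}^t(w_{p,k-1}^t),\quad 1\le k\le N^t;\qquad\text{then}\qquad \hat w^t=\frac1P\sum_{p=1}^P w_{p,N^t}^t .$$ Write $N_1^t=N^1+\dots+N^t$, $T=P\,N_1^C$ (the total number of gradients), and $$\overline{\overline w}^C=\frac1{P\,N_1^C}\sum_{t=1}^C\sum_{p=1}^P\sum_{k=1}^{N^t}w_{p,k}^t$$ for the Polyak–Ruppert average. **Oracle (assumed in both parts).** The gradient fields $g_{p,k}^t$ are i.i.d. measurable random fields, i.e. $g_{p,k}^t(w)=G(Z_{p,k}^t,w)$ with i.i.d. random elements $Z_{p,k}^t$ ($1\le t\le C$, $1\le k\le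 N^t$, $1\le p\le P$) of a measurable space and $G$ jointly measurable. There is a filtration $(\mathcal H^t_k)$, indexed by the pairs $(t,k)$ in lexicographic order, such that for every $w$ the integrable variable $g_{p,k}^t(w)$ is $\mathcal H_k^t$-measurable and $\mathbb E[g_{p,k}^t(w)\mid\mathcal H_{k-1}^t]=F'(w)$. **Mini-batch rate.** For $\mu>0$ and $L,M,\sigma\ge0$ put $$\mathcal R(\mu,L,M,\sigma)=\frac{\|w_0-w^\star\|^2}{\eta^2X^2}\Big(1+\frac{M^2}{\mu^2}\|w_0-w^\star\|^2+\frac{L^2\eta}{\mu P}\Big)+\frac{\sigma^2}{T}\Big(1+\frac1P\Big(\frac{L^2\eta}{\mu}+\frac{P}{X\eta\mu}\Big)+\frac1{P^2}\,\frac{M^2XP\eta^2\sigma^2}{\mu^2}\Big),\qquad X=N_1^C .$$ Up to an absolute constant this is the bound for mini-batch averaging with the same number of machines, iterations and gradients. **Theorem.** In each of the following two settings the averaged Local-SGD iterate converges as well as mini-batch averaging, up to a constant factor. 1. *(Quadratic case.)* For every $A$ there is a constant $K$, depending only on $A$, such that the following holds. Let $F(w)=\frac12\|\Sigma^{1/2}(w-w^\star)\|^2$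 with $\Sigma$ positive definite and all eigenvalues of $\Sigma$ in $[\mu,L]$, where $\mu>0$ (for example $\mu,L$ the smallest and the largest eigenvalue), and $2\eta L\le1$. Suppose that almost surely every $g=g_{p,k}^t$ is $L$-co-coercive, i.e. $\|g(w_1)-g(w_2)\|^2\le L\langle g(w_1)-g(w_2),w_1-w_2\rangle$ for all $w_1,w_2$, that $\mathbb E\|g_{p,k}^t(w^\star)\|^4\le\sigma^4$, and that $N^t\le\frac1{\mu\eta P}$ and $\mu\eta^2N_1^t\le A$ for all $t\le C$. Then $$\mathbb E\big\|F''(w^\star)(\overline{\overline w}^C-w^\star)\big\|^2\le K\,\mathcal R(\mu,L,0,\sigma).$$ 2. *(Strongly convex case.)* For every $\kappa$ there is a constant $K$, depending only on $\kappa$, such that the following holds. Let $F$ be $\mu$-strongly convex with $\mu>0$ and $C^3$ with $\|F''\|\le L$ and $\|F'''\|\le M$ everywhere, with $L/\mu\le\kappa$ and $2\eta L\le1$. Suppose that $\mathbb E\|g_{p,k}^t(w)-F'(w)\|^2\le\sigma_\infty^2$ for all $w$, $p$, $t$, $k$, and that for all $t\le C$ $$N^t\le\min\Big(\frac1{\eta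 PM\,\mathbb E\|\hat w^t-w^\star\|},\ \frac1{\mu\eta P}\Big)$$ (with $1/0=\infty$), an adaptive communication frequency. Then $$\mathbb E\big\|F''(w^\star)(\overline{\overline w}^C-w^\star)\big\|^2\le K\,\mathcal R(\mu,L,M,\sigma_\infty).$$ -/

import Mathlib

open MeasureTheory ProbabilityTheory Finset

noncomputable section

namespace LocalSGD

/-- The Euclidean space `ℝ^d` with its canonical inner product. -/
abbrev Vec (d : ℕ) : Type := EuclideanSpace ℝ (Fin d)

/-! ### The algorithm, along one realisation of the gradient fields -/

/-- `k` local steps of SGD with constant step size `η`, started at `w`; `g k` is the gradient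
field queried at the `k`-th step (`k ≥ 1`). -/
def innerIter {d : ℕ} (η : ℝ) (g : ℕ → Vec d → Vec d) (w : Vec d) : ℕ → Vec d
  | 0 => w
  | k + 1 => innerIter η g w k - η • g (k + 1) (innerIter η g w k)

/-- The model `ŵ^t` after the `t`-th communication: `ŵ^0 = w₀`, and `ŵ^{t+1}` is the average over
the `P` machines of the results of `N (t+1)` local steps, all started at `ŵ^t`.
`g t k p` is the gradient field of machine `p` at local step `k` of phase `t` (`t, k ≥ 1`). -/
def communicated {d P : ℕ} (η : ℝ) (N : ℕ → ℕ) (g : ℕ → ℕ → Fin P → Vec d → Vec d)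
    (w₀ : Vec d) : ℕ → Vec d
  | 0 => w₀
  | t + 1 => (P : ℝ)⁻¹ • ∑ p : Fin P,
      innerIter η (fun k => g (t + 1) k p) (communicated η N g w₀ t) (N (t + 1))

/-- The local iterate `w_{p,k}^t` of machine `p` after `k` local steps of phase `t ≥ 1`. -/
def localIter {d P : ℕ} (η : ℝ) (N : ℕ → ℕ) (g : ℕ → ℕ → Fin P → Vec d → Vec d)
    (w₀ : Vec d) (t k : ℕ) (p : Fin P) : Vec d :=
  innerIter η (fun j => g t j p) (communicated η N g w₀ (t - 1)) k

/-- `N_1^t = N^1 + ⋯ + N^t`, the number of local steps made by each machine in phases `1, …, t`. -/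
def totalSteps (N : ℕ → ℕ) (t : ℕ) : ℕ := ∑ s ∈ Icc 1 t, N s

/-- The Polyak–Ruppert average of all the local iterates of all the machines over `C` phases. -/
def polyakRuppert {d P : ℕ} (η : ℝ) (C : ℕ) (N : ℕ → ℕ)
    (g : ℕ → ℕ → Fin P → Vec d → Vec d) (w₀ : Vec d) : Vec d :=
  ((P : ℝ) * (totalSteps N C : ℝ))⁻¹ •
    ∑ t ∈ Icc 1 C, ∑ p : Fin P, ∑ k ∈ Icc 1 (N t), localIter η N g w₀ t k p

/-! ### Assumptions on the objective function -/

/-- `F` is the quadratic function `w ↦ ‖S^{1/2} (w - w⋆)‖² / 2 = ⟪w - w⋆, S (w - w⋆)⟫ / 2` for a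
positive definite matrix `S`. -/
def IsQuadratic {d : ℕ} (F : Vec d → ℝ) (wstar : Vec d) (S : Matrix (Fin d) (Fin d) ℝ) : Prop :=
  S.PosDef ∧ ∀ w, F w = inner ℝ (w - wstar) (Matrix.toEuclideanLin S (w - wstar)) / 2

/-- All the eigenvalues of the symmetric matrix `S` lie in `[μ, L]`. -/
def SpectrumBetween {d : ℕ} (S : Matrix (Fin d) (Fin d) ℝ) (μ L : ℝ) : Prop :=
  ∀ a ∈ spectrum ℝ S, μ ≤ a ∧ a ≤ L

/-- `F` is three times continuously differentiable, and its second and third derivatives are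
bounded in operator norm by `L` and `M` respectively. -/
def SmoothRegular {d : ℕ} (F : Vec d → ℝ) (L M : ℝ) : Prop :=
  ContDiff ℝ 3 F ∧ (∀ w, ‖iteratedFDeriv ℝ 2 F w‖ ≤ L) ∧ (∀ w, ‖iteratedFDeriv ℝ 3 F w‖ ≤ M)

/-- The second derivative `F''(w)`, as a linear operator: the derivative of the gradient. -/
def hess {d : ℕ} (F : Vec d → ℝ) (w : Vec d) : Vec d →L[ℝ] Vec d := fderiv ℝ (gradient F) w

/-! ### Assumptions on the stochastic gradients

The random gradient fields are `g_{p,k}^t(w) = G (Z t k p) w`, where the samples `Z t k p` are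
random elements of a measurable space `Ξ` and `G` is jointly measurable. -/

/-- The indices `(t, k, p)` that occur in the algorithm: `1 ≤ t ≤ C`, `1 ≤ k ≤ N^t`, `p ≤ P`. -/
abbrev StepIndex (C : ℕ) (N : ℕ → ℕ) (P : ℕ) : Type :=
  {i : ℕ × ℕ × Fin P // i.1 ∈ Icc 1 C ∧ i.2.1 ∈ Icc 1 (N i.1)}

/-- The random gradient field of step `i = (t, k, p)`. -/
def field {d P : ℕ} {Ω Ξ : Type*} (G : Ξ → Vec d → Vec d) (Z : ℕ → ℕ → Fin P → Ω → Ξ)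
    {C : ℕ} {N : ℕ → ℕ} (i : StepIndex C N P) (w : Vec d) (ω : Ω) : Vec d :=
  G (Z i.1.1 i.1.2.1 i.1.2.2 ω) w

/-- The oracle assumption: the random fields are i.i.d., and for some filtration `ℋ`, indexed by
the pairs `(t, k)` in lexicographic order, `g_{p,k+1}^t(w)` is `ℋ (t, k+1)`-measurable with
conditional expectation `F'(w)` given `ℋ (t, k)`. -/
structure GradientOracle {d P : ℕ} {Ω Ξ : Type*} [mΩ : MeasurableSpace Ω] [MeasurableSpace Ξ]
    (Pr : Measure Ω) (F : Vec d → ℝ) (C : ℕ) (N : ℕ → ℕ)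
    (G : Ξ → Vec d → Vec d) (Z : ℕ → ℕ → Fin P → Ω → Ξ) : Prop where
  measurable_field : Measurable (Function.uncurry G)
  measurable_sample : ∀ i : StepIndex C N P, Measurable (Z i.1.1 i.1.2.1 i.1.2.2)
  indep : iIndepFun (fun i : StepIndex C N P => Z i.1.1 i.1.2.1 i.1.2.2) Pr
  identDistrib : ∀ i j : StepIndex C N P,
    IdentDistrib (Z i.1.1 i.1.2.1 i.1.2.2) (Z j.1.1 j.1.2.1 j.1.2.2) Pr Pr
  unbiased : ∃ ℋ : Filtration (ℕ ×ₗ ℕ) mΩ, ∀ (i : StepIndex C N P) (w : Vec d),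
    Measurable[ℋ (toLex (i.1.1, i.1.2.1))] (field G Z i w) ∧
    Integrable (field G Z i w) Pr ∧
    Pr[field G Z i w | ℋ (toLex (i.1.1, i.1.2.1 - 1))] =ᵐ[Pr] fun _ => gradient F w

/-- The random gradient fields are almost surely `L`-co-coercive. -/
def Cocoercive {d P : ℕ} {Ω Ξ : Type*} [MeasurableSpace Ω] (Pr : Measure Ω) (C : ℕ) (N : ℕ → ℕ)
    (G : Ξ → Vec d → Vec d) (Z : ℕ → ℕ → Fin P → Ω → Ξ) (L : ℝ) : Prop :=
  ∀ i : StepIndex C N P, ∀ᵐ ω ∂Pr, ∀ w₁ w₂ : Vec d,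
    ‖field G Z i w₁ ω - field G Z i w₂ ω‖ ^ 2
      ≤ L * inner ℝ (field G Z i w₁ ω - field G Z i w₂ ω) (w₁ - w₂)

/-- The random gradients at `w⋆` have a fourth moment, which is at most `σ ^ 4`. -/
def FourthMomentAt {d P : ℕ} {Ω Ξ : Type*} [MeasurableSpace Ω] (Pr : Measure Ω) (C : ℕ)
    (N : ℕ → ℕ) (G : Ξ → Vec d → Vec d) (Z : ℕ → ℕ → Fin P → Ω → Ξ) (wstar : Vec d)
    (σ : ℝ) : Prop :=
  ∀ i : StepIndex C N P, Integrable (fun ω => ‖field G Z i wstar ω‖ ^ 4) Pr ∧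
    ∫ ω, ‖field G Z i wstar ω‖ ^ 4 ∂Pr ≤ σ ^ 4

/-- The variance of the random gradients is at most `σ ^ 2`, uniformly over the space. -/
def BoundedVariance {d P : ℕ} {Ω Ξ : Type*} [MeasurableSpace Ω] (Pr : Measure Ω) (F : Vec d → ℝ)
    (C : ℕ) (N : ℕ → ℕ) (G : Ξ → Vec d → Vec d) (Z : ℕ → ℕ → Fin P → Ω → Ξ) (σ : ℝ) : Prop :=
  ∀ (i : StepIndex C N P) (w : Vec d),
    Integrable (fun ω => ‖field G Z i w ω - gradient F w‖ ^ 2) Pr ∧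
      ∫ ω, ‖field G Z i w ω - gradient F w‖ ^ 2 ∂Pr ≤ σ ^ 2

/-! ### The mini-batch rate -/

/-- `Q_bias`, where `r = ‖w₀ - w⋆‖`. -/
def Qbias (μ L M η r : ℝ) (P : ℕ) : ℝ := 1 + M ^ 2 / μ ^ 2 * r ^ 2 + L ^ 2 * η / (μ * P)

/-- `Q_{1,var}(X)`. -/
def Q1var (μ L η : ℝ) (P X : ℕ) : ℝ := L ^ 2 * η / μ + P / (X * η * μ)

/-- `Q_{2,var}(X)`. -/
def Q2var (μ M η σ : ℝ) (P X : ℕ) : ℝ := M ^ 2 * X * P * η ^ 2 * σ ^ 2 / μ ^ 2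

/-- The rate of mini-batch averaging with `P` machines after `X` iterations, i.e. after
`T = P X` stochastic gradients, where `r = ‖w₀ - w⋆‖`. -/
def miniBatchRate (μ L M η σ r : ℝ) (P X : ℕ) : ℝ :=
  r ^ 2 / (η ^ 2 * X ^ 2) * Qbias μ L M η r P
    + σ ^ 2 / (P * X) * (1 + Q1var μ L η P X / P + Q2var μ M η σ P X / P ^ 2)

/-- The error `‖F''(w⋆)(w̄ - w⋆)‖²` of the averaged iterate of Local-SGD. -/
def sqError {d P : ℕ} {Ω Ξ : Type*} (F : Vec d → ℝ) (wstar w₀ : Vec d) (η : ℝ) (C : ℕ)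
    (N : ℕ → ℕ) (G : Ξ → Vec d → Vec d) (Z : ℕ → ℕ → Fin P → Ω → Ξ) (ω : Ω) : ℝ :=
  ‖hess F wstar (polyakRuppert η C N (fun t k p => G (Z t k p ω)) w₀ - wstar)‖ ^ 2

end LocalSGD

end

noncomputable section

namespace LocalSGD

/-! Write `H = F''(w⋆)` and let `w̄` be the mean iterate over the machines. Adding up the steps
telescopes: `η H ∑ (w̄ - w⋆) = (1 - η H)(w₀ - w̄_end) - η ∑ ξ + η ∑ ρ`, where `ξ` is the mean noise
of a step and `ρ = H (w̄ - w⋆) - avg F'(w_p)` its curvature residual (`norm_residual_le`).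
Communication changes nothing here, since it preserves the mean. So it suffices to bound the second
moments of the final error, of `∑ ξ` and of `∑ ρ` (`integral_sqError_le`). Each bound comes from a
potential that decreases in mean along the chain of states (`lintegral_chainSync_le`); the samples
of a step are independent of the past, so a step can be analysed with the iterates frozen.

Quadratic case: `ρ = 0`. Co-coercivity bounds the variance of the noise at `w` by `2 L ⟪A e, e⟫ + 2
σ²`, with `e = w - w⋆`. The first term is paid for by the decrease of the mean of `‖e_p‖²` over the
machines, which communication cannot increase by convexity (`meanLE_quadratic_step`).

Strongly convex case: the noise variance is bounded, and the work lies in `∑ ρ`. The estimate `‖ρ‖ ≤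
M avg ‖e_p‖²` would need fourth moments of the iterates, whereas the noise has only second moments.
But also `‖ρ‖ ≤ 2 L avg ‖e_p‖`, and the smaller of the two bounds, at each machine, is a multiple of
the pseudo-Huber function `ψ` with crossover radius `L / M`. This `ψ` is at most a multiple of
`‖·‖²`, which makes its mean small, and at most `‖·‖`, so its square needs second moments only. Both
`ψ` and `‖·‖²` are a `Gauge`: convexity handles averages, monotonicity contractions, smoothness
centred noise.

Within a phase the machines drift apart. `lyapunov` weighs their spread by the number of local steps
left: each step releases one unit of spread, enough to pay for what the spread does to the mean, and
the bound on `N^t` keeps the weighted noise at the mini-batch level (`Gauge.meanLE_lyapunov`).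
Summing gives the first moment of the accumulated deviation, and `accPotential` upgrades this to its
second moment. -/

/-! ### Averages over the machines -/

/-- The average of a finite family. -/
def avg {P : ℕ} {V : Type*} [AddCommGroup V] [Module ℝ V] (x : Fin P → V) : V :=
  (P : ℝ)⁻¹ • ∑ p, x p

section Avg

variable {P : ℕ} {V W : Type*} [AddCommGroup V] [Module ℝ V] [AddCommGroup W] [Module ℝ W]

lemma avg_add (x y : Fin P → V) : avg (fun p => x p + y p) = avg x + avg y := by
  simp [avg, Finset.sum_add_distrib]

lemma avg_sub (x y : Fin P → V) : avg (fun p => x p - y p) = avg x - avg y := by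
  simp [avg, Finset.sum_sub_distrib, smul_sub]

lemma avg_smul (c : ℝ) (x : Fin P → V) : avg (fun p => c • x p) = c • avg x := by
  simp only [avg, ← Finset.smul_sum]
  rw [smul_comm]

lemma avg_mul (c : ℝ) (x : Fin P → ℝ) : avg (fun p => c * x p) = c * avg x := by
  simpa using avg_smul c x

lemma avg_const [NeZero P] (c : V) : avg (fun _ : Fin P => c) = c := by
  have h : (P : ℝ) ≠ 0 := Nat.cast_ne_zero.mpr (NeZero.ne P)
  simp [avg, ← Nat.cast_smul_eq_nsmul ℝ, smul_smul, h]

lemma map_avg (f : V →ₗ[ℝ] W) (x : Fin P → V) : f (avg x) = avg (fun p => f (x p)) := by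
  simp [avg, map_sum]

lemma avg_mono {x y : Fin P → ℝ} (h : ∀ p, x p ≤ y p) : avg x ≤ avg y := by
  simp only [avg, smul_eq_mul]
  exact mul_le_mul_of_nonneg_left (Finset.sum_le_sum fun p _ => h p) (by positivity)

lemma avg_nonneg {x : Fin P → ℝ} (h : ∀ p, 0 ≤ x p) : 0 ≤ avg x := by
  simp only [avg, smul_eq_mul]
  exact mul_nonneg (by positivity) (Finset.sum_nonneg fun p _ => h p)

lemma norm_avg_le {E : Type*} [SeminormedAddCommGroup E] [NormedSpace ℝ E] (x : Fin P → E) :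
    ‖avg x‖ ≤ avg (fun p => ‖x p‖) := by
  simp only [avg, smul_eq_mul, norm_smul, norm_inv, Real.norm_natCast]
  exact mul_le_mul_of_nonneg_left (norm_sum_le _ _) (by positivity)

lemma convexOn_map_avg_le [NeZero P] {f : V → ℝ} (hf : ConvexOn ℝ Set.univ f) (x : Fin P → V) :
    f (avg x) ≤ avg (fun p => f (x p)) := by
  have h : (P : ℝ) ≠ 0 := Nat.cast_ne_zero.mpr (NeZero.ne P)
  have := hf.map_sum_le (t := (Finset.univ : Finset (Fin P))) (w := fun _ => (P : ℝ)⁻¹) (p := x)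
    (fun _ _ => by positivity) (by simp [h]) (by simp)
  simpa [avg, Finset.smul_sum, Finset.mul_sum] using this

lemma sq_avg_le [NeZero P] (x : Fin P → ℝ) : avg x ^ 2 ≤ avg (fun p => x p ^ 2) :=
  convexOn_map_avg_le (f := fun y : ℝ => y ^ 2) (even_two.convexOn_pow) x

lemma measurable_avg {E X : Type*} [NormedAddCommGroup E] [NormedSpace ℝ E] [MeasurableSpace E]
    [BorelSpace E] [SecondCountableTopology E] [MeasurableSpace X]
    {f : X → Fin P → E} (hf : ∀ p, Measurable fun x => f x p) :
    Measurable fun x => avg (f x) := by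
  unfold avg; fun_prop

end Avg

/-! ### Gauges: smooth convex functions of the norm of at most quadratic growth -/

/-- `ψ` is a convex increasing function of the norm, vanishing at `0`, of at most quadratic
growth, and `2 m`-smooth. -/
structure Gauge {d : ℕ} (ψ : Vec d → ℝ) (m : ℝ) : Prop where
  continuous : Continuous ψ
  zero : ψ 0 = 0
  convexOn : ConvexOn ℝ Set.univ ψ
  mono : ∀ x y, ‖x‖ ≤ ‖y‖ → ψ x ≤ ψ y
  scale : ∀ (c : ℝ) (x : Vec d), 1 ≤ c → ψ (c • x) ≤ c ^ 2 * ψ x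
  smooth : ∀ x, ∃ v, ∀ y, ψ (x + y) ≤ ψ x + inner ℝ v y + m * ‖y‖ ^ 2
  nonneg_const : 0 ≤ m

lemma Gauge.nonneg {d : ℕ} {ψ : Vec d → ℝ} {m : ℝ} (h : Gauge ψ m) (x : Vec d) : 0 ≤ ψ x := by
  rw [← h.zero]; exact h.mono _ _ (by simp)

lemma convexOn_norm_sq {d : ℕ} : ConvexOn ℝ Set.univ fun x : Vec d => ‖x‖ ^ 2 :=
  (convexOn_norm convex_univ).pow (fun _ _ => norm_nonneg _) 2

lemma gauge_norm_sq {d : ℕ} : Gauge (fun x : Vec d => ‖x‖ ^ 2) 1 where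
  continuous := by fun_prop
  zero := by simp
  convexOn := convexOn_norm_sq
  mono x y h := by gcongr
  scale c x _ := by rw [norm_smul, mul_pow, Real.norm_eq_abs, sq_abs]
  smooth x := ⟨(2 : ℝ) • x, fun y => by rw [norm_add_sq_real, inner_smul_left]; simp⟩
  nonneg_const := zero_le_one

/-- The pseudo-Huber function with parameter `a`. -/
def huber {d : ℕ} (a : ℝ) (x : Vec d) : ℝ := √(a ^ 2 + ‖x‖ ^ 2) - a

section Huber

variable {d : ℕ} {a : ℝ}

/-- Rationalising the difference: the comparisons with `‖x‖²` below come from bounding the conjugate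
factor. -/
lemma huber_mul (x : Vec d) :
    huber a x * (√(a ^ 2 + ‖x‖ ^ 2) + a) = ‖x‖ ^ 2 := by
  have := Real.sq_sqrt (show 0 ≤ a ^ 2 + ‖x‖ ^ 2 by positivity)
  unfold huber; linear_combination this

lemma le_sqrt_huber (x : Vec d) : a ≤ √(a ^ 2 + ‖x‖ ^ 2) :=
  Real.le_sqrt_of_sq_le (by nlinarith [sq_nonneg ‖x‖])

lemma sqrt_huber_le (ha : 0 < a) (x : Vec d) : √(a ^ 2 + ‖x‖ ^ 2) ≤ a + ‖x‖ :=
  Real.sqrt_le_iff.mpr ⟨by positivity, by nlinarith [mul_nonneg ha.le (norm_nonneg x)]⟩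

lemma huber_nonneg (x : Vec d) : 0 ≤ huber a x :=
  sub_nonneg.mpr (le_sqrt_huber x)

lemma huber_le_norm (ha : 0 < a) (x : Vec d) : huber a x ≤ ‖x‖ := by
  have := sqrt_huber_le ha x
  unfold huber; linarith

lemma huber_le_norm_sq (ha : 0 < a) (x : Vec d) : huber a x ≤ 1 / (2 * a) * ‖x‖ ^ 2 := by
  have h1 := huber_mul (a := a) x
  have h2 := le_sqrt_huber (a := a) x
  have h3 := huber_nonneg (a := a) x
  rw [one_div, ← div_eq_inv_mul, le_div_iff₀ (by positivity), ← h1]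
  exact mul_le_mul_of_nonneg_left (by linarith) h3

/-- The minimum of a quadratic and a linear function of the norm is at most a multiple of the
pseudo-Huber function. -/
lemma le_huber (ha : 0 < a) (x : Vec d) {y : ℝ} (h1 : y ≤ ‖x‖ ^ 2) (h2 : y ≤ a * ‖x‖) :
    y ≤ 3 * a * huber a x := by
  have hm := huber_mul (a := a) x
  have hl := sqrt_huber_le ha x
  have hn := huber_nonneg (a := a) x
  have h3 : ‖x‖ ^ 2 ≤ huber a x * (2 * a + ‖x‖) := by
    rw [← hm]; exact mul_le_mul_of_nonneg_left (by linarith) hn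
  -- The quadratic bound decides inside the radius `a`, the linear bound outside.
  rcases le_total ‖x‖ a with h | h
  · nlinarith [mul_le_mul_of_nonneg_left h hn]
  · have h4 : ‖x‖ ^ 2 ≤ huber a x * (3 * ‖x‖) :=
      h3.trans (mul_le_mul_of_nonneg_left (by linarith) hn)
    have hx : 0 < ‖x‖ := ha.trans_le h
    have h5 : ‖x‖ ≤ 3 * huber a x := by
      have : ‖x‖ * ‖x‖ ≤ 3 * huber a x * ‖x‖ := by nlinarith
      exact le_of_mul_le_mul_right this hx
    calc y ≤ a * ‖x‖ := h2
      _ ≤ a * (3 * huber a x) := by gcongr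
      _ = _ := by ring

/-- The square root is the Euclidean norm of the pair `(a, ‖x‖)`, so convexity is Minkowski's
inequality. -/
lemma convexOn_huber (ha : 0 < a) : ConvexOn ℝ Set.univ (huber a : Vec d → ℝ) := by
  refine ⟨convex_univ, fun x _ y _ s t hs ht hst => ?_⟩
  set u := √(a ^ 2 + ‖x‖ ^ 2) with hu
  set v := √(a ^ 2 + ‖y‖ ^ 2) with hv
  have hu2 : u ^ 2 = a ^ 2 + ‖x‖ ^ 2 := Real.sq_sqrt (by positivity)
  have hv2 : v ^ 2 = a ^ 2 + ‖y‖ ^ 2 := Real.sq_sqrt (by positivity)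
  have hu0 : 0 ≤ u := Real.sqrt_nonneg _
  have hv0 : 0 ≤ v := Real.sqrt_nonneg _
  -- Cauchy–Schwarz for the pairs `(a, ‖x‖)` and `(a, ‖y‖)`.
  have huv : a ^ 2 + ‖x‖ * ‖y‖ ≤ u * v := by
    refine le_of_sq_le_sq ?_ (by positivity)
    rw [mul_pow, hu2, hv2]
    nlinarith [sq_nonneg (a * (‖x‖ - ‖y‖))]
  have hn : ‖s • x + t • y‖ ≤ s * ‖x‖ + t * ‖y‖ := by
    refine (norm_add_le _ _).trans_eq ?_
    rw [norm_smul, norm_smul, Real.norm_of_nonneg hs, Real.norm_of_nonneg ht]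
  have key : √(a ^ 2 + ‖s • x + t • y‖ ^ 2) ≤ s * u + t * v := by
    refine Real.sqrt_le_iff.mpr ⟨by positivity, ?_⟩
    have h1 : ‖s • x + t • y‖ ^ 2 ≤ (s * ‖x‖ + t * ‖y‖) ^ 2 := by gcongr
    have h2 : a ^ 2 = (s + t) ^ 2 * a ^ 2 := by rw [hst]; ring
    have h3 := mul_le_mul_of_nonneg_left huv (mul_nonneg hs ht)
    have h4 : (s * u + t * v) ^ 2
        = s ^ 2 * (a ^ 2 + ‖x‖ ^ 2) + t ^ 2 * (a ^ 2 + ‖y‖ ^ 2) + 2 * (s * t * (u * v)) := by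
      rw [← hu2, ← hv2]; ring
    rw [h4]
    linarith [h1, h2, h3]
  simp only [huber, smul_eq_mul, ← hu, ← hv]
  have : s * (u - a) + t * (v - a) = s * u + t * v - a := by linear_combination -a * hst
  linarith

lemma gauge_huber (ha : 0 < a) : Gauge (huber a : Vec d → ℝ) (1 / (2 * a)) where
  continuous := by unfold huber; fun_prop
  zero := by simp [huber, Real.sqrt_sq ha.le]
  convexOn := convexOn_huber ha
  mono x y h := by unfold huber; gcongr
  -- The function is `‖x‖²` divided by a quantity which increases with `‖x‖`, so it grows at most
  -- quadratically.
  scale c x hc := by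
    have h1 := huber_mul (a := a) x
    have h2 := huber_mul (a := a) (c • x)
    have h3 : ‖x‖ ≤ ‖c • x‖ := by
      rw [norm_smul, Real.norm_of_nonneg (by linarith)]
      exact le_mul_of_one_le_left (norm_nonneg _) hc
    have h4 : √(a ^ 2 + ‖x‖ ^ 2) ≤ √(a ^ 2 + ‖c • x‖ ^ 2) := by gcongr
    have h5 : 0 < √(a ^ 2 + ‖x‖ ^ 2) + a := add_pos_of_nonneg_of_pos (Real.sqrt_nonneg _) ha
    refine le_of_mul_le_mul_right ?_ h5
    calc huber a (c • x) * (√(a ^ 2 + ‖x‖ ^ 2) + a)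
        ≤ huber a (c • x) * (√(a ^ 2 + ‖c • x‖ ^ 2) + a) :=
          mul_le_mul_of_nonneg_left (by linarith) (huber_nonneg _)
      _ = c ^ 2 * ‖x‖ ^ 2 := by
          rw [h2, norm_smul, mul_pow, Real.norm_eq_abs, sq_abs]
      _ = _ := by linear_combination (-c ^ 2) * h1
  smooth x := by
    set u := √(a ^ 2 + ‖x‖ ^ 2) with hu
    have hua : a ≤ u := le_sqrt_huber x
    have hu0 : 0 < u := ha.trans_le hua
    have hu2 : u ^ 2 = a ^ 2 + ‖x‖ ^ 2 := Real.sq_sqrt (by positivity)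
    refine ⟨u⁻¹ • x, fun y => ?_⟩
    -- The tangent to the square root at `u²` lies above its graph. The quadratic term then has
    -- coefficient `1 / (2u) ≤ 1 / (2a)`.
    have h1 : √(a ^ 2 + ‖x + y‖ ^ 2) ≤ u + u⁻¹ * (inner ℝ x y + ‖y‖ ^ 2 / 2) := by
      have h0 : 0 ≤ a ^ 2 + ‖x + y‖ ^ 2 := by positivity
      have h2 : a ^ 2 + ‖x + y‖ ^ 2 = u ^ 2 + 2 * (inner ℝ x y + ‖y‖ ^ 2 / 2) := by
        rw [norm_add_sq_real, hu2]; ring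
      have h3 : u + u⁻¹ * (inner ℝ x y + ‖y‖ ^ 2 / 2) = (u ^ 2 + (a ^ 2 + ‖x + y‖ ^ 2)) / (2 * u) := by
        rw [h2]; field_simp; ring
      rw [h3, le_div_iff₀ (by positivity)]
      nlinarith [Real.sq_sqrt h0, sq_nonneg (√(a ^ 2 + ‖x + y‖ ^ 2) - u)]
    have h4 : u⁻¹ * (‖y‖ ^ 2 / 2) ≤ 1 / (2 * a) * ‖y‖ ^ 2 := by
      have : u⁻¹ ≤ a⁻¹ := inv_anti₀ ha hua
      calc u⁻¹ * (‖y‖ ^ 2 / 2) ≤ a⁻¹ * (‖y‖ ^ 2 / 2) := by gcongr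
        _ = _ := by field_simp
    rw [inner_smul_left]
    simp only [huber, ← hu, conj_trivial]
    linarith
  nonneg_const := by positivity

end Huber

/-! ### Upper bounds for means -/

section MeanLE

variable {Ω : Type*} [MeasurableSpace Ω] {Pr : Measure Ω}

/-- `f` is dominated by an integrable function of mean at most `c`. -/
def MeanLE (Pr : Measure Ω) (f : Ω → ℝ) (c : ℝ) : Prop :=
  ∃ g : Ω → ℝ, Integrable g Pr ∧ (∀ᵐ ω ∂Pr, f ω ≤ g ω) ∧ ∫ ω, g ω ∂Pr ≤ c

lemma MeanLE.const [IsProbabilityMeasure Pr] (c : ℝ) : MeanLE Pr (fun _ => c) c :=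
  ⟨fun _ => c, integrable_const c, by simp, by simp⟩

lemma MeanLE.add {f₁ f₂ : Ω → ℝ} {c₁ c₂ : ℝ} (h₁ : MeanLE Pr f₁ c₁) (h₂ : MeanLE Pr f₂ c₂) :
    MeanLE Pr (fun ω => f₁ ω + f₂ ω) (c₁ + c₂) := by
  obtain ⟨g₁, hi₁, hf₁, hc₁⟩ := h₁
  obtain ⟨g₂, hi₂, hf₂, hc₂⟩ := h₂
  refine ⟨fun ω => g₁ ω + g₂ ω, hi₁.add hi₂, ?_, ?_⟩
  · filter_upwards [hf₁, hf₂] with ω h1 h2 using add_le_add h1 h2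
  · rw [integral_add hi₁ hi₂]; exact add_le_add hc₁ hc₂

lemma MeanLE.const_mul {f : Ω → ℝ} {c a : ℝ} (ha : 0 ≤ a) (h : MeanLE Pr f c) :
    MeanLE Pr (fun ω => a * f ω) (a * c) := by
  obtain ⟨g, hi, hf, hc⟩ := h
  refine ⟨fun ω => a * g ω, hi.const_mul a, ?_, ?_⟩
  · filter_upwards [hf] with ω h1 using mul_le_mul_of_nonneg_left h1 ha
  · rw [integral_const_mul]; exact mul_le_mul_of_nonneg_left hc ha

lemma MeanLE.mono {f f' : Ω → ℝ} {c c' : ℝ} (h : MeanLE Pr f c) (hf : ∀ ω, f' ω ≤ f ω)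
    (hc : c ≤ c') : MeanLE Pr f' c' := by
  obtain ⟨g, hi, hg, hgc⟩ := h
  exact ⟨g, hi, hg.mono fun ω h => (hf ω).trans h, hgc.trans hc⟩

lemma MeanLE.avg {P : ℕ} {f : Fin P → Ω → ℝ} {c : Fin P → ℝ} (h : ∀ p, MeanLE Pr (f p) (c p)) :
    MeanLE Pr (fun ω => avg fun p => f p ω) (avg c) := by
  choose g hi hf hc using h
  refine ⟨fun ω => LocalSGD.avg fun p => g p ω, ?_, ?_, ?_⟩
  · simp only [LocalSGD.avg]
    exact (integrable_finsetSum _ fun p _ => hi p).smul (P : ℝ)⁻¹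
  · filter_upwards [ae_all_iff.mpr hf] with ω h using avg_mono h
  · simp only [LocalSGD.avg]
    rw [integral_smul, integral_finsetSum _ fun p _ => hi p]
    exact avg_mono (x := fun p => ∫ ω, g p ω ∂Pr) hc

/-- The potentials are followed along the chain with the lower Lebesgue integral, so no
integrability of the iterates is needed in advance; it is recovered at the end by
`integrable_of_lintegral_le`. -/
lemma MeanLE.lintegral_le {f : Ω → ℝ} {c : ℝ} (h : MeanLE Pr f c) (h0 : ∀ ω, 0 ≤ f ω) :
    ∫⁻ ω, ENNReal.ofReal (f ω) ∂Pr ≤ ENNReal.ofReal c := by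
  obtain ⟨g, hi, hf, hc⟩ := h
  refine le_trans (lintegral_mono_ae (hf.mono fun ω h => ENNReal.ofReal_le_ofReal h)) ?_
  rw [← ofReal_integral_eq_lintegral_ofReal hi (hf.mono fun ω h => (h0 ω).trans h)]
  exact ENNReal.ofReal_le_ofReal hc

lemma integrable_of_lintegral_le {f : Ω → ℝ} (hf : Measurable f) (h0 : ∀ ω, 0 ≤ f ω) {c : ℝ}
    (hc : 0 ≤ c) (h : ∫⁻ ω, ENNReal.ofReal (f ω) ∂Pr ≤ ENNReal.ofReal c) :
    Integrable f Pr ∧ ∫ ω, f ω ∂Pr ≤ c := by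
  refine ⟨⟨hf.aestronglyMeasurable, ?_⟩, ?_⟩
  · rw [hasFiniteIntegral_iff_ofReal (ae_of_all _ h0)]
    exact h.trans_lt ENNReal.ofReal_lt_top
  · rw [integral_eq_lintegral_of_nonneg_ae (ae_of_all _ h0) hf.aestronglyMeasurable]
    exact ENNReal.toReal_le_of_le_ofReal hc h

end MeanLE

/-! ### Centred uncorrelated noise -/

section Noise

variable {Ω : Type*} [MeasurableSpace Ω] {Pr : Measure Ω} {d P : ℕ}

lemma integrable_inner_of_sq {x y : Ω → Vec d} (hx : Integrable x Pr) (hy : Integrable y Pr)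
    (hx2 : Integrable (fun ω => ‖x ω‖ ^ 2) Pr) (hy2 : Integrable (fun ω => ‖y ω‖ ^ 2) Pr) :
    Integrable (fun ω => inner ℝ (x ω) (y ω)) Pr := by
  refine (hx2.add hy2).mono' (hx.1.inner hy.1) (ae_of_all _ fun ω => ?_)
  refine (norm_inner_le_norm _ _).trans ?_
  have := two_mul_le_add_sq ‖x ω‖ ‖y ω‖
  simp only [Pi.add_apply]
  nlinarith [norm_nonneg (x ω), norm_nonneg (y ω)]

/-- The linear term of the smoothness inequality has mean zero; only `m` times the second moment
survives. -/
lemma Gauge.meanLE [IsProbabilityMeasure Pr] {ψ : Vec d → ℝ} {m : ℝ} (hψ : Gauge ψ m)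
    {y : Ω → Vec d} {τ : ℝ} (hy : Integrable y Pr) (hy0 : ∫ ω, y ω ∂Pr = 0)
    (hy2 : Integrable (fun ω => ‖y ω‖ ^ 2) Pr) (hτ : ∫ ω, ‖y ω‖ ^ 2 ∂Pr ≤ τ) (x : Vec d) :
    MeanLE Pr (fun ω => ψ (x + y ω)) (ψ x + m * τ) := by
  obtain ⟨v, hv⟩ := hψ.smooth x
  have h1 : Integrable (fun ω => inner ℝ v (y ω)) Pr := hy.const_inner v
  refine ⟨fun ω => ψ x + inner ℝ v (y ω) + m * ‖y ω‖ ^ 2,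
    ((integrable_const _).add h1).add (hy2.const_mul m), ae_of_all _ fun ω => hv _, ?_⟩
  have h2 : ∫ ω, (ψ x + inner ℝ v (y ω) + m * ‖y ω‖ ^ 2) ∂Pr
      = ∫ ω, (ψ x + inner ℝ v (y ω)) ∂Pr + ∫ ω, m * ‖y ω‖ ^ 2 ∂Pr :=
    integral_add ((integrable_const _).add h1) (hy2.const_mul m)
  rw [h2, integral_add (integrable_const _) h1, integral_const_mul, integral_inner hy, hy0]
  simpa using mul_le_mul_of_nonneg_left hτ hψ.nonneg_const

/-- Centred, pairwise uncorrelated, square-integrable random vectors with second moments at most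
`τ p`. -/
structure Noise (Pr : Measure Ω) (ξ : Fin P → Ω → Vec d) (τ : Fin P → ℝ) : Prop where
  integrable : ∀ p, Integrable (ξ p) Pr
  centred : ∀ p, ∫ ω, ξ p ω ∂Pr = 0
  integrable_sq : ∀ p, Integrable (fun ω => ‖ξ p ω‖ ^ 2) Pr
  sq_le : ∀ p, ∫ ω, ‖ξ p ω‖ ^ 2 ∂Pr ≤ τ p
  uncorrelated : ∀ p q, p ≠ q → ∫ ω, inner ℝ (ξ p ω) (ξ q ω) ∂Pr = 0

namespace Noise

variable {ξ : Fin P → Ω → Vec d} {τ : Fin P → ℝ}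

lemma integrable_avg (h : Noise Pr ξ τ) : Integrable (fun ω => avg fun p => ξ p ω) Pr := by
  simp only [avg]
  exact (integrable_finsetSum _ fun p _ => h.integrable p).smul (P : ℝ)⁻¹

lemma integral_avg (h : Noise Pr ξ τ) : ∫ ω, avg (fun p => ξ p ω) ∂Pr = 0 := by
  simp only [avg]
  rw [integral_smul, integral_finsetSum _ fun p _ => h.integrable p]
  simp [h.centred]

lemma norm_sq_avg (x : Fin P → Vec d) :
    ‖avg x‖ ^ 2 = ((P : ℝ)⁻¹) ^ 2 * ∑ p, ∑ q, inner ℝ (x p) (x q) := by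
  rw [← real_inner_self_eq_norm_sq]
  simp only [avg, inner_smul_left, inner_smul_right, sum_inner, inner_sum, conj_trivial]
  rw [sq, mul_assoc, Finset.sum_comm]
  simp only [Finset.mul_sum]

lemma integrable_inner (h : Noise Pr ξ τ) (p q : Fin P) :
    Integrable (fun ω => inner ℝ (ξ p ω) (ξ q ω)) Pr :=
  integrable_inner_of_sq (h.integrable p) (h.integrable q) (h.integrable_sq p) (h.integrable_sq q)

lemma integrable_avg_sq (h : Noise Pr ξ τ) :
    Integrable (fun ω => ‖avg fun p => ξ p ω‖ ^ 2) Pr := by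
  simp only [norm_sq_avg]
  exact (integrable_finsetSum _ fun p _ =>
    integrable_finsetSum _ fun q _ => h.integrable_inner p q).const_mul _

/-- The cross terms vanish, which gains the factor `1 / P` of mini-batch averaging. -/
lemma integral_avg_sq (h : Noise Pr ξ τ) :
    ∫ ω, ‖avg fun p => ξ p ω‖ ^ 2 ∂Pr ≤ (P : ℝ)⁻¹ * avg τ := by
  simp only [norm_sq_avg]
  rw [integral_const_mul, integral_finsetSum _ fun p _ =>
    integrable_finsetSum _ fun q _ => h.integrable_inner p q, sq, mul_assoc]
  refine mul_le_mul_of_nonneg_left ?_ (by positivity)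
  refine mul_le_mul_of_nonneg_left (Finset.sum_le_sum fun p _ => ?_) (by positivity)
  rw [integral_finsetSum _ fun q _ => h.integrable_inner p q, Finset.sum_eq_single p]
  · simpa only [real_inner_self_eq_norm_sq] using h.sq_le p
  · intro q _ hq; exact h.uncorrelated p q hq.symm
  · simp

variable [IsProbabilityMeasure Pr] {ψ : Vec d → ℝ} {m : ℝ}

lemma meanLE_avg (h : Noise Pr ξ τ) (hψ : Gauge ψ m) (x : Vec d) (c : ℝ) :
    MeanLE Pr (fun ω => ψ (x + c • avg fun p => ξ p ω))
      (ψ x + m * (c ^ 2 * ((P : ℝ)⁻¹ * avg τ))) := by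
  refine hψ.meanLE (h.integrable_avg.smul c) ?_ ?_ ?_ x
  · simp only [Pi.smul_apply]
    rw [integral_smul, h.integral_avg, smul_zero]
  · simp only [Pi.smul_apply, norm_smul, mul_pow]; exact h.integrable_avg_sq.const_mul _
  · simp only [Pi.smul_apply, norm_smul, mul_pow, Real.norm_eq_abs, sq_abs]
    rw [integral_const_mul]
    exact mul_le_mul_of_nonneg_left h.integral_avg_sq (by positivity)

lemma meanLE_single (h : Noise Pr ξ τ) (hψ : Gauge ψ m) (x : Vec d) (c : ℝ) (p : Fin P) :
    MeanLE Pr (fun ω => ψ (x + c • ξ p ω)) (ψ x + m * (c ^ 2 * τ p)) := by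
  refine hψ.meanLE ((h.integrable p).smul c) ?_ ?_ ?_ x
  · simp only [Pi.smul_apply]
    rw [integral_smul, h.centred, smul_zero]
  · simp only [Pi.smul_apply, norm_smul, mul_pow]; exact (h.integrable_sq p).const_mul _
  · simp only [Pi.smul_apply, norm_smul, mul_pow, Real.norm_eq_abs, sq_abs]
    rw [integral_const_mul]
    exact mul_le_mul_of_nonneg_left (h.sq_le p) (by positivity)

lemma meanLE_sub (h : Noise Pr ξ τ) (hψ : Gauge ψ m) (x : Vec d) (c : ℝ) (p q : Fin P) :
    MeanLE Pr (fun ω => ψ (x + c • (ξ p ω - ξ q ω)))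
      (ψ x + m * (c ^ 2 * (2 * τ p + 2 * τ q))) := by
  have hi := (h.integrable p).sub (h.integrable q)
  have hle : ∀ ω, ‖ξ p ω - ξ q ω‖ ^ 2 ≤ 2 * ‖ξ p ω‖ ^ 2 + 2 * ‖ξ q ω‖ ^ 2 := fun ω => by
    have := parallelogram_law_with_norm ℝ (ξ p ω) (ξ q ω)
    nlinarith [mul_self_nonneg ‖ξ p ω + ξ q ω‖]
  have hi2 := ((h.integrable_sq p).const_mul 2).add ((h.integrable_sq q).const_mul 2)
  have hsq : Integrable (fun ω => ‖ξ p ω - ξ q ω‖ ^ 2) Pr := by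
    refine hi2.mono' (hi.1.norm.pow 2) (ae_of_all _ fun ω => ?_)
    rw [Real.norm_of_nonneg (by positivity)]
    exact hle ω
  refine hψ.meanLE (hi.smul c) ?_ ?_ ?_ x
  · simp only [Pi.smul_apply, Pi.sub_apply]
    rw [integral_smul, integral_sub (h.integrable p) (h.integrable q), h.centred, h.centred]
    simp
  · simp only [Pi.smul_apply, Pi.sub_apply, norm_smul, mul_pow]; exact hsq.const_mul _
  · simp only [Pi.smul_apply, Pi.sub_apply, norm_smul, mul_pow, Real.norm_eq_abs, sq_abs]
    rw [integral_const_mul]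
    refine mul_le_mul_of_nonneg_left ((integral_mono hsq hi2 hle).trans ?_) (by positivity)
    simp only [Pi.add_apply]
    rw [integral_add ((h.integrable_sq p).const_mul 2) ((h.integrable_sq q).const_mul 2),
      integral_const_mul, integral_const_mul]
    linarith [h.sq_le p, h.sq_le q]

end Noise

end Noise

/-! ### Chains driven by independent inputs, with synchronisations -/

section Chain

variable {𝒮 𝒵 : Type*}

/-- `k` steps of the chain within a phase, driven by `z 1, …, z k`. -/
def chainRun (step : 𝒮 → 𝒵 → 𝒮) (z : ℕ → 𝒵) (s : 𝒮) : ℕ → 𝒮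
  | 0 => s
  | k + 1 => step (chainRun step z s k) (z (k + 1))

/-- The state of the chain after `t` phases, each followed by a synchronisation. -/
def chainSync (step : 𝒮 → 𝒵 → 𝒮) (sync : 𝒮 → 𝒮) (N : ℕ → ℕ) (z : ℕ → ℕ → 𝒵) (s : 𝒮) : ℕ → 𝒮
  | 0 => s
  | t + 1 => sync (chainRun step (z (t + 1)) (chainSync step sync N z s t) (N (t + 1)))

lemma chain_invariant {step : 𝒮 → 𝒵 → 𝒮} {sync : 𝒮 → 𝒮} {N : ℕ → ℕ} {z : ℕ → ℕ → 𝒵} {s : 𝒮}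
    (I : 𝒮 → Prop) (h0 : I s) (hstep : ∀ s z, I s → I (step s z)) (hsync : ∀ s, I s → I (sync s))
    (t : ℕ) : I (chainSync step sync N z s t) := by
  have run : ∀ (z : ℕ → 𝒵) s, I s → ∀ k, I (chainRun step z s k) := fun z s hs k => by
    induction k with
    | zero => exact hs
    | succ k ih => exact hstep _ _ ih
  induction t with
  | zero => exact h0
  | succ t ih => exact hsync _ (run _ _ ih _)

lemma totalSteps_zero (N : ℕ → ℕ) : totalSteps N 0 = 0 := by simp [totalSteps]

lemma totalSteps_succ (N : ℕ → ℕ) (t : ℕ) :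
    totalSteps N (t + 1) = totalSteps N t + N (t + 1) := by
  simp [totalSteps, Finset.sum_Icc_succ_top]

lemma totalSteps_mono (N : ℕ → ℕ) : Monotone (totalSteps N) :=
  monotone_nat_of_le_succ fun t => by rw [totalSteps_succ]; omega

variable {Ω : Type*} [mΩ : MeasurableSpace Ω]

/-- The inputs `Z t k` of the phases `1, …, C` are adapted to `ℱ`, and each is independent of the
past. -/
structure AdaptedInputs [MeasurableSpace 𝒵] (Pr : Measure Ω) (C : ℕ) (N : ℕ → ℕ)
    (Z : ℕ → ℕ → Ω → 𝒵) (ℱ : ℕ → ℕ → MeasurableSpace Ω) : Prop where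
  le : ∀ t k, ℱ t k ≤ mΩ
  mono : ∀ t k, ℱ t k ≤ ℱ t (k + 1)
  mono_phase : ∀ t, ℱ t (N t) ≤ ℱ (t + 1) 0
  measurable : ∀ t k, t < C → k < N (t + 1) → Measurable[ℱ (t + 1) (k + 1)] (Z (t + 1) (k + 1))
  indep : ∀ t k, t < C → k < N (t + 1) →
    Indep (ℱ (t + 1) k) (MeasurableSpace.comap (Z (t + 1) (k + 1)) inferInstance) Pr

variable [MeasurableSpace 𝒮] [MeasurableSpace 𝒵] {step : 𝒮 → 𝒵 → 𝒮} {sync : 𝒮 → 𝒮}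
  {Pr : Measure Ω} {C : ℕ} {N : ℕ → ℕ} {Z : ℕ → ℕ → Ω → 𝒵} {ℱ : ℕ → ℕ → MeasurableSpace Ω}

lemma measurable_chainRun (hstep : Measurable (Function.uncurry step))
    (hZ : AdaptedInputs Pr C N Z ℱ) {t : ℕ} (ht : t < C) {X : Ω → 𝒮}
    (hX : Measurable[ℱ (t + 1) 0] X) (k : ℕ) (hk : k ≤ N (t + 1)) :
    Measurable[ℱ (t + 1) k] fun ω => chainRun step (fun j => Z (t + 1) j ω) (X ω) k := by
  induction k with
  | zero => exact hX
  | succ k ih =>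
    have h1 := (ih (by omega)).mono (hZ.mono (t + 1) k) le_rfl
    exact hstep.comp (h1.prodMk (hZ.measurable t k ht (by omega)))

lemma measurable_chainSync (hstep : Measurable (Function.uncurry step)) (hsync : Measurable sync)
    (hZ : AdaptedInputs Pr C N Z ℱ) (s : 𝒮) (t : ℕ) (ht : t ≤ C) :
    Measurable[ℱ (t + 1) 0] fun ω => chainSync step sync N (fun t k => Z t k ω) s t := by
  induction t with
  | zero => exact @measurable_const _ _ _ (ℱ (0 + 1) 0) _
  | succ t ih =>
    have h1 := measurable_chainRun hstep hZ (by omega) (ih (by omega)) (N (t + 1)) le_rfl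
    exact hsync.comp (h1.mono (hZ.mono_phase (t + 1)) le_rfl)

/-- By independence and Fubini, the state may be frozen while the new sample is integrated out. -/
lemma lintegral_step_le [IsProbabilityMeasure Pr] (hstep : Measurable (Function.uncurry step))
    {X : Ω → 𝒮} {ζ : Ω → 𝒵} (hX : Measurable X) (hζ : Measurable ζ) (hi : IndepFun X ζ Pr)
    {V V' : 𝒮 → ENNReal} (hV' : Measurable V')
    (h : ∀ s, ∫⁻ ω, V' (step s (ζ ω)) ∂Pr ≤ V s) :
    ∫⁻ ω, V' (step (X ω) (ζ ω)) ∂Pr ≤ ∫⁻ ω, V (X ω) ∂Pr := by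
  have hmap := (indepFun_iff_map_prod_eq_prod_map_map hX.aemeasurable hζ.aemeasurable).mp hi
  have hφ : Measurable fun x : 𝒮 × 𝒵 => V' (step x.1 x.2) := hV'.comp hstep
  have hpm : IsProbabilityMeasure (Measure.map ζ Pr) := Measure.isProbabilityMeasure_map hζ.aemeasurable
  calc ∫⁻ ω, V' (step (X ω) (ζ ω)) ∂Pr
      = ∫⁻ x, V' (step x.1 x.2) ∂(Measure.map (fun ω => (X ω, ζ ω)) Pr) :=
        (lintegral_map hφ (hX.prodMk hζ)).symm
    _ = ∫⁻ s, ∫⁻ z, V' (step s z) ∂(Measure.map ζ Pr) ∂(Measure.map X Pr) := by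
        rw [hmap, lintegral_prod _ hφ.aemeasurable]
    _ = ∫⁻ ω, ∫⁻ z, V' (step (X ω) z) ∂(Measure.map ζ Pr) ∂Pr :=
        lintegral_map hφ.lintegral_prod_right' hX
    _ ≤ _ := lintegral_mono fun ω => by
        have h1 : Measurable fun z => V' (step (X ω) z) := hφ.comp measurable_prodMk_left
        rw [lintegral_map h1 hζ]
        exact h _

/-- A potential which decreases in mean at each step and at each synchronisation decreases in
mean along the chain. The arguments of the potential are the number of steps left in total, the
number of steps left in the phase, and the state. -/
theorem lintegral_chainSync_le [IsProbabilityMeasure Pr]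
    (hstep : Measurable (Function.uncurry step)) (hsync : Measurable sync)
    (hZ : AdaptedInputs Pr C N Z ℱ) {V : ℕ → ℕ → 𝒮 → ℝ} (hVm : ∀ R n, Measurable (V R n))
    (hV0 : ∀ R n s, 0 ≤ V R n s) {s : 𝒮} {v : ℝ} (hinit : ∀ n, V (totalSteps N C) n s ≤ v)
    (hVsync : ∀ R n s, V R n (sync s) ≤ V R 0 s)
    (hVstep : ∀ t k R n, t < C → k < N (t + 1) → n < N (t + 1) → R < totalSteps N C →
      ∀ s, MeanLE Pr (fun ω => V R n (step s (Z (t + 1) (k + 1) ω))) (V (R + 1) (n + 1) s)) :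
    ∫⁻ ω, ENNReal.ofReal (V 0 0 (chainSync step sync N (fun t k => Z t k ω) s C)) ∂Pr
      ≤ ENNReal.ofReal v := by
  -- The counter `n` stays universally quantified: after a synchronisation it can be restarted at
  -- the length of the next phase.
  have key : ∀ t, t ≤ C → ∀ n, ∫⁻ ω, ENNReal.ofReal (V (totalSteps N C - totalSteps N t) n
      (chainSync step sync N (fun t k => Z t k ω) s t)) ∂Pr ≤ ENNReal.ofReal v := by
    intro t
    induction t with
    | zero =>
      intro _ n
      simp only [totalSteps_zero, Nat.sub_zero, chainSync, lintegral_const, measure_univ, mul_one]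
      exact ENNReal.ofReal_le_ofReal (hinit n)
    | succ t ih =>
      intro ht n
      have htot : totalSteps N t + N (t + 1) ≤ totalSteps N C := by
        rw [← totalSteps_succ]; exact totalSteps_mono N ht
      have run : ∀ k, k ≤ N (t + 1) →
          ∫⁻ ω, ENNReal.ofReal (V (totalSteps N C - totalSteps N t - k) (N (t + 1) - k)
            (chainRun step (fun j => Z (t + 1) j ω)
              (chainSync step sync N (fun t k => Z t k ω) s t) k)) ∂Pr ≤ ENNReal.ofReal v := by
        intro k
        induction k with
        | zero => intro _; exact ih (by omega) _
        | succ k ihk =>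
          intro hk
          refine le_trans ?_ (ihk (by omega))
          obtain ⟨R, hR⟩ : ∃ R, totalSteps N C - totalSteps N t - k = R + 1 :=
            ⟨totalSteps N C - totalSteps N t - k - 1, by omega⟩
          obtain ⟨n, hn⟩ : ∃ n, N (t + 1) - k = n + 1 := ⟨N (t + 1) - k - 1, by omega⟩
          rw [hR, hn, show totalSteps N C - totalSteps N t - (k + 1) = R by omega,
            show N (t + 1) - (k + 1) = n by omega]
          have hX := measurable_chainRun hstep hZ (by omega)
            (measurable_chainSync hstep hsync hZ s t (by omega)) k (by omega)
          have hζ := hZ.measurable t k (by omega) (by omega)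
          have hi := hZ.indep t k (by omega) (by omega)
          refine lintegral_step_le hstep (hX.mono (hZ.le _ _) le_rfl) (hζ.mono (hZ.le _ _) le_rfl)
            ((IndepFun_iff_Indep _ _ _).mpr (indep_of_indep_of_le_left hi hX.comap_le))
            (V := fun s => ENNReal.ofReal (V (R + 1) (n + 1) s))
            (V' := fun s => ENNReal.ofReal (V R n s)) (hVm R n).ennreal_ofReal fun s => ?_
          exact (hVstep t k R n (by omega) (by omega) (by omega) (by omega) s).lintegral_le
            fun ω => hV0 _ _ _
      refine le_trans (lintegral_mono fun ω => ?_) (run (N (t + 1)) le_rfl)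
      rw [Nat.sub_self, Nat.sub_sub, ← totalSteps_succ]
      exact ENNReal.ofReal_le_ofReal (hVsync _ _ _)
  simpa using key C le_rfl 0

end Chain

/-! ### The gradient oracle -/

section Oracle

variable {d P C : ℕ} {N : ℕ → ℕ} {Ω Ξ : Type*} [mΩ : MeasurableSpace Ω] [MeasurableSpace Ξ]
  {Pr : Measure Ω} {F : Vec d → ℝ} {G : Ξ → Vec d → Vec d} {Z : ℕ → ℕ → Fin P → Ω → Ξ}

/-- The indices of the samples drawn up to the `k`-th step of phase `t`. -/
def pastIndices (C : ℕ) (N : ℕ → ℕ) (P t k : ℕ) : Set (StepIndex C N P) :=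
  {i | i.1.1 < t ∨ (i.1.1 = t ∧ i.1.2.1 ≤ k)}

/-- The information contained in the samples drawn up to the `k`-th step of phase `t`. -/
@[reducible] def pastInfo (C : ℕ) (N : ℕ → ℕ) (Z : ℕ → ℕ → Fin P → Ω → Ξ) (t k : ℕ) : MeasurableSpace Ω :=
  ⨆ i ∈ pastIndices C N P t k, MeasurableSpace.comap (Z i.1.1 i.1.2.1 i.1.2.2) inferInstance

/-- The index of the sample of machine `p` at local step `k + 1` of phase `t + 1`. -/
def stepIndex {t k : ℕ} (ht : t < C) (hk : k < N (t + 1)) (p : Fin P) : StepIndex C N P :=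
  ⟨(t + 1, k + 1, p), by simp only [Finset.mem_Icc]; omega, by simp only [Finset.mem_Icc]; omega⟩

/-- The past and the samples of the next step are generated by disjoint blocks of an independent
family. -/
lemma GradientOracle.adaptedInputs (h : GradientOracle Pr F C N G Z) :
    AdaptedInputs Pr C N (fun t k ω p => Z t k p ω) (pastInfo C N Z) where
  le t k := iSup₂_le fun i _ => (h.measurable_sample i).comap_le
  mono t k := biSup_mono fun i hi => by
    simp only [pastIndices, Set.mem_ofPred_eq] at hi ⊢; omega
  mono_phase t := biSup_mono fun i hi => by
    simp only [pastIndices, Set.mem_ofPred_eq] at hi ⊢; omega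
  measurable t k ht hk := by
    refine @measurable_pi_lambda _ _ _ (pastInfo C N Z (t + 1) (k + 1)) _ _ fun p => ?_
    refine Measurable.mono (comap_measurable (Z (t + 1) (k + 1) p)) ?_ le_rfl
    exact le_iSup₂_of_le (stepIndex ht hk p) (Or.inr ⟨rfl, le_rfl⟩) le_rfl
  indep t k ht hk := by
    have hdisj : Disjoint (pastIndices C N P (t + 1) k)
        {i : StepIndex C N P | i.1.1 = t + 1 ∧ i.1.2.1 = k + 1} := by
      rw [Set.disjoint_left]
      intro i hi hi'
      simp only [pastIndices, Set.mem_ofPred_eq] at hi hi'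
      omega
    refine indep_of_indep_of_le_right (indep_iSup_of_disjoint
      (fun i => (h.measurable_sample i).comap_le) ((iIndepFun_iff_iIndep _ _ _).mp h.indep) hdisj) ?_
    refine Measurable.comap_le ?_
    refine @measurable_pi_lambda _ _ _ (_) _ _ fun p => ?_
    refine Measurable.mono (comap_measurable (Z (t + 1) (k + 1) p)) ?_ le_rfl
    exact le_iSup₂_of_le (stepIndex ht hk p) ⟨rfl, rfl⟩ le_rfl

lemma GradientOracle.integrable (h : GradientOracle Pr F C N G Z) (i : StepIndex C N P)
    (w : Vec d) : Integrable (field G Z i w) Pr :=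
  let ⟨_, hℋ⟩ := h.unbiased
  (hℋ i w).2.1

lemma GradientOracle.integral_field [IsProbabilityMeasure Pr] (h : GradientOracle Pr F C N G Z)
    (i : StepIndex C N P) (w : Vec d) : ∫ ω, field G Z i w ω ∂Pr = gradient F w := by
  obtain ⟨ℋ, hℋ⟩ := h.unbiased
  rw [← integral_condExp (ℋ.le (toLex (i.1.1, i.1.2.1 - 1))), integral_congr_ae (hℋ i w).2.2]
  simp

/-- The iterates `w` are frozen here; different machines then have independent centred noises, hence
uncorrelated ones. -/
lemma GradientOracle.noise [IsProbabilityMeasure Pr] (h : GradientOracle Pr F C N G Z)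
    {t k : ℕ} (ht : t < C) (hk : k < N (t + 1)) (w : Fin P → Vec d) {τ : Fin P → ℝ}
    (hτ : ∀ p, Integrable (fun ω => ‖field G Z (stepIndex ht hk p) (w p) ω
        - gradient F (w p)‖ ^ 2) Pr ∧
      ∫ ω, ‖field G Z (stepIndex ht hk p) (w p) ω - gradient F (w p)‖ ^ 2 ∂Pr ≤ τ p) :
    Noise Pr (fun p ω => G (Z (t + 1) (k + 1) p ω) (w p) - gradient F (w p)) τ := by
  have hint : ∀ p, Integrable (fun ω => G (Z (t + 1) (k + 1) p ω) (w p) - gradient F (w p)) Pr :=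
    fun p => (h.integrable (stepIndex ht hk p) (w p)).sub (integrable_const _)
  have hc : ∀ p, ∫ ω, (G (Z (t + 1) (k + 1) p ω) (w p) - gradient F (w p)) ∂Pr = 0 := fun p => by
    have h1 := h.integral_field (stepIndex ht hk p) (w p)
    have h2 := integral_sub (h.integrable (stepIndex ht hk p) (w p))
      (integrable_const (μ := Pr) (gradient F (w p)))
    rw [h1] at h2
    exact h2.trans (by simp)
  refine ⟨hint, hc, fun p => (hτ p).1, fun p => (hτ p).2, fun p q hpq => ?_⟩
  have hne : stepIndex ht hk p ≠ stepIndex ht hk q := fun heq => hpq <| by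
    have := congrArg (fun i : StepIndex C N P => i.1.2.2) heq
    simpa [stepIndex] using this
  have hG : ∀ p, Measurable fun x => G x (w p) - gradient F (w p) := fun p =>
    (h.measurable_field.comp (measurable_id.prodMk measurable_const)).sub_const _
  have hi := (h.indep.indepFun hne).comp (hG p) (hG q)
  have := hi.integral_bilin (hint p) (hint q) (innerSL ℝ)
  refine this.trans ?_
  have h0 := hc p
  simp only [Function.comp_def]
  change innerSL ℝ (∫ ω, (G (Z (t + 1) (k + 1) p ω) (w p) - gradient F (w p)) ∂Pr) _ = 0
  rw [h0]
  simp

end Oracle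

/-! ### Local SGD as a chain -/

section Machine

variable {d P : ℕ} {Ξ : Type*}

/-- The local iterates, the sum of the past mean errors, the sum of the past mean noises, and an
accumulated functional of the past iterates. -/
abbrev State (d P : ℕ) : Type := (Fin P → Vec d) × Vec d × Vec d × ℝ

/-- One local step of every machine, where `f` is the mean gradient field and `U` is the
functional to be accumulated. -/
def sgdStep (η : ℝ) (f : Vec d → Vec d) (U : (Fin P → Vec d) → ℝ) (wstar : Vec d)
    (G : Ξ → Vec d → Vec d) (s : State d P) (z : Fin P → Ξ) : State d P :=
  (fun p => s.1 p - η • G (z p) (s.1 p),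
    s.2.1 + (avg (fun p => s.1 p - η • G (z p) (s.1 p)) - wstar),
    s.2.2.1 + avg (fun p => G (z p) (s.1 p) - f (s.1 p)),
    s.2.2.2 + U s.1)

/-- The communication: every machine receives the average of the iterates. -/
def sgdSync (s : State d P) : State d P := (fun _ => avg s.1, s.2)

lemma measurable_sgdStep [MeasurableSpace Ξ] (η : ℝ) {f : Vec d → Vec d} (hf : Measurable f)
    {U : (Fin P → Vec d) → ℝ} (hU : Measurable U) (wstar : Vec d) {G : Ξ → Vec d → Vec d}
    (hG : Measurable (Function.uncurry G)) :
    Measurable (Function.uncurry (sgdStep η f U wstar G : State d P → _)) := by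
  have hs : ∀ p, Measurable fun x : State d P × (Fin P → Ξ) => x.1.1 p := fun p => by fun_prop
  have hg : ∀ p, Measurable fun x : State d P × (Fin P → Ξ) => G (x.2 p) (x.1.1 p) := fun p =>
    hG.comp (((measurable_pi_apply p).comp measurable_snd).prodMk (hs p))
  have h1 : ∀ p, Measurable fun x : State d P × (Fin P → Ξ) => x.1.1 p - η • G (x.2 p) (x.1.1 p) :=
    fun p => (hs p).sub ((hg p).const_smul η)
  have h2 : ∀ p, Measurable fun x : State d P × (Fin P → Ξ) =>
      G (x.2 p) (x.1.1 p) - f (x.1.1 p) := fun p => (hg p).sub (hf.comp (hs p))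
  refine (measurable_pi_lambda _ h1).prodMk (Measurable.prodMk ?_ (Measurable.prodMk ?_ ?_))
  · exact (by fun_prop : Measurable fun x : State d P × (Fin P → Ξ) => x.1.2.1).add
      ((measurable_avg h1).sub_const _)
  · exact (by fun_prop : Measurable fun x : State d P × (Fin P → Ξ) => x.1.2.2.1).add
      (measurable_avg h2)
  · exact (by fun_prop : Measurable fun x : State d P × (Fin P → Ξ) => x.1.2.2.2).add
      (hU.comp (by fun_prop))

lemma measurable_sgdSync : Measurable (sgdSync : State d P → State d P) := by
  unfold sgdSync
  refine (measurable_pi_lambda _ fun _ => measurable_avg fun p => ?_).prodMk measurable_snd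
  fun_prop

variable (η : ℝ) (f : Vec d → Vec d) (U : (Fin P → Vec d) → ℝ) (wstar : Vec d)
  (G : Ξ → Vec d → Vec d)

lemma chainRun_iterates (z : ℕ → Fin P → Ξ) (s : State d P) (v : Vec d) (hs : s.1 = fun _ => v)
    (k : ℕ) : (chainRun (sgdStep η f U wstar G) z s k).1
      = fun p => innerIter η (fun j => G (z j p)) v k := by
  induction k with
  | zero => exact hs
  | succ k ih =>
    funext p
    simp only [chainRun, sgdStep, innerIter, ih]

lemma chainRun_sum (z : ℕ → Fin P → Ξ) (s : State d P) (v : Vec d) (hs : s.1 = fun _ => v)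
    (k : ℕ) : (chainRun (sgdStep η f U wstar G) z s k).2.1
      = s.2.1 + ∑ j ∈ Icc 1 k, (avg (fun p => innerIter η (fun j => G (z j p)) v j) - wstar) := by
  induction k with
  | zero => simp [chainRun]
  | succ k ih =>
    rw [Finset.sum_Icc_succ_top (by omega), ← add_assoc, ← ih,
      ← chainRun_iterates η f U wstar G z s v hs (k + 1)]
    simp only [chainRun, sgdStep]

lemma chainSync_iterates (N : ℕ → ℕ) (z : ℕ → ℕ → Fin P → Ξ) (w₀ : Vec d) (t : ℕ) :
    (chainSync (sgdStep η f U wstar G) sgdSync N z ((fun _ => w₀, 0, 0, 0) : State d P) t).1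
      = fun _ => communicated η N (fun t k p => G (z t k p)) w₀ t := by
  induction t with
  | zero => rfl
  | succ t ih =>
    funext p
    simp only [chainSync, sgdSync, communicated]
    rw [chainRun_iterates η f U wstar G _ _ _ ih]
    rfl

lemma chainSync_sum (N : ℕ → ℕ) (z : ℕ → ℕ → Fin P → Ξ) (w₀ : Vec d) (t : ℕ) :
    (chainSync (sgdStep η f U wstar G) sgdSync N z ((fun _ => w₀, 0, 0, 0) : State d P) t).2.1
      = ∑ s ∈ Icc 1 t, ∑ j ∈ Icc 1 (N s),
        (avg (fun p => localIter η N (fun t k p => G (z t k p)) w₀ s j p) - wstar) := by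
  induction t with
  | zero => rfl
  | succ t ih =>
    rw [Finset.sum_Icc_succ_top (by omega), ← ih]
    simp only [chainSync, sgdSync]
    rw [chainRun_sum η f U wstar G _ _ _ (chainSync_iterates η f U wstar G N z w₀ t)]
    rfl

lemma polyakRuppert_sub (hP : 1 ≤ P) {C : ℕ} {N : ℕ → ℕ} (hX : 0 < totalSteps N C)
    (z : ℕ → ℕ → Fin P → Ξ) (w₀ : Vec d) :
    polyakRuppert η C N (fun t k p => G (z t k p)) w₀ - wstar = (totalSteps N C : ℝ)⁻¹ •
      (chainSync (sgdStep η f U wstar G) sgdSync N z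
        ((fun _ => w₀, 0, 0, 0) : State d P) C).2.1 := by
  have hP0 : (P : ℝ) ≠ 0 := by positivity
  have hX0 : (totalSteps N C : ℝ) ≠ 0 := by positivity
  have hconst : ∑ s ∈ Icc 1 C, ∑ _j ∈ Icc 1 (N s), wstar = (totalSteps N C : ℝ) • wstar := by
    simp [totalSteps, ← Nat.cast_smul_eq_nsmul ℝ, Finset.sum_smul]
  rw [chainSync_sum]
  simp only [Finset.sum_sub_distrib]
  rw [hconst, smul_sub, smul_smul, inv_mul_cancel₀ hX0, one_smul, polyakRuppert, mul_inv, mul_comm,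
    mul_smul]
  simp only [avg, ← Finset.smul_sum]
  congr 3
  exact Finset.sum_congr rfl fun s _ => Finset.sum_comm

end Machine

/-! ### The error of the averaged iterate -/

section Error

variable {d P : ℕ} {Ξ : Type*} {η : ℝ} {f : Vec d → Vec d} {U : (Fin P → Vec d) → ℝ} {wstar w₀ : Vec d}
  {G : Ξ → Vec d → Vec d} {H : Vec d →L[ℝ] Vec d} {c : ℝ}

/-- The bracketed vector vanishes initially, is unchanged by a synchronisation, and grows by exactly
`η` times the curvature residual at each step. The term `η • H (w₀ - avg s.1)` is there because the
sum runs over the iterates after each step instead of before it. -/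
lemma norm_residual_le [NeZero P] (hη : 0 ≤ η)
    (hf : ∀ w : Fin P → Vec d, ‖H (avg w - wstar) - avg (fun p => f (w p))‖ ≤ c * U w)
    (N : ℕ → ℕ) (z : ℕ → ℕ → Fin P → Ξ) (t : ℕ)
    (s : State d P)
    (hs : s = chainSync (sgdStep η f U wstar G) sgdSync N z (fun _ => w₀, 0, 0, 0) t) :
    ‖η • H s.2.1 - ((w₀ - avg s.1) - η • H (w₀ - avg s.1)) + η • s.2.2.1‖
      ≤ η * (c * s.2.2.2) := by
  rw [hs]
  refine chain_invariant (fun s : State d P =>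
    ‖η • H s.2.1 - ((w₀ - avg s.1) - η • H (w₀ - avg s.1)) + η • s.2.2.1‖
      ≤ η * (c * s.2.2.2)) ?_ ?_ ?_ t
  · simp [avg_const]
  · intro s z ih
    have h1 : η • H (sgdStep η f U wstar G s z).2.1
          - ((w₀ - avg (sgdStep η f U wstar G s z).1)
            - η • H (w₀ - avg (sgdStep η f U wstar G s z).1))
          + η • (sgdStep η f U wstar G s z).2.2.1
        = (η • H s.2.1 - ((w₀ - avg s.1) - η • H (w₀ - avg s.1)) + η • s.2.2.1)
          + η • (H (avg s.1 - wstar) - avg (fun p => f (s.1 p))) := by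
      simp only [sgdStep, avg_sub, avg_smul, map_add, map_sub, map_smul]
      module
    simp only [h1]
    refine (norm_add_le _ _).trans ?_
    have h2 : ‖η • (H (avg s.1 - wstar) - avg (fun p => f (s.1 p)))‖ ≤ η * (c * U s.1) := by
      rw [norm_smul, Real.norm_of_nonneg hη]
      exact mul_le_mul_of_nonneg_left (hf _) hη
    calc _ ≤ η * (c * s.2.2.2) + η * (c * U s.1) := add_le_add ih h2
      _ = _ := by simp only [sgdStep]; ring
  · intro s ih
    simpa only [sgdSync, avg_const] using ih

lemma norm_sq_sum_le [NeZero P] (hη : 0 < η) (hH : ∀ v, ‖v - η • H v‖ ≤ ‖v‖)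
    (hf : ∀ w : Fin P → Vec d, ‖H (avg w - wstar) - avg (fun p => f (w p))‖ ≤ c * U w)
    (N : ℕ → ℕ) (z : ℕ → ℕ → Fin P → Ξ) (t : ℕ) (s : State d P)
    (hs : s = chainSync (sgdStep η f U wstar G) sgdSync N z (fun _ => w₀, 0, 0, 0) t) :
    ‖H s.2.1‖ ^ 2 ≤ 4 * (‖w₀ - wstar‖ ^ 2 / η ^ 2 + ‖avg s.1 - wstar‖ ^ 2 / η ^ 2
      + ‖s.2.2.1‖ ^ 2 + c ^ 2 * s.2.2.2 ^ 2) := by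
  have h1 := norm_residual_le hη.le hf N z t s hs
  set r := η • H s.2.1 - ((w₀ - avg s.1) - η • H (w₀ - avg s.1)) + η • s.2.2.1 with hr
  have h2 : η • H s.2.1 = r + ((w₀ - avg s.1) - η • H (w₀ - avg s.1)) - η • s.2.2.1 := by
    rw [hr]; module
  have h3 : ‖w₀ - avg s.1‖ ≤ ‖w₀ - wstar‖ + ‖avg s.1 - wstar‖ := by
    have := norm_sub_le (w₀ - wstar) (avg s.1 - wstar)
    rwa [sub_sub_sub_cancel_right] at this
  have h4 : η * ‖H s.2.1‖ ≤ η * (c * s.2.2.2) + (‖w₀ - wstar‖ + ‖avg s.1 - wstar‖)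
      + η * ‖s.2.2.1‖ := by
    calc η * ‖H s.2.1‖ = ‖η • H s.2.1‖ := by rw [norm_smul, Real.norm_of_nonneg hη.le]
      _ ≤ ‖r‖ + ‖(w₀ - avg s.1) - η • H (w₀ - avg s.1)‖ + ‖η • s.2.2.1‖ := by
        rw [h2]; exact (norm_sub_le _ _).trans (by gcongr; exact norm_add_le _ _)
      _ ≤ _ := by
        rw [norm_smul, Real.norm_of_nonneg hη.le]
        gcongr
        exact (hH _).trans h3
  have h5 : ‖H s.2.1‖ ≤ c * s.2.2.2 + ‖w₀ - wstar‖ / η + ‖avg s.1 - wstar‖ / η + ‖s.2.2.1‖ := by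
    refine le_of_mul_le_mul_left (h4.trans_eq ?_) hη
    field_simp
    ring
  rw [← div_pow, ← div_pow, ← mul_pow]
  set x := c * s.2.2.2
  set y := ‖w₀ - wstar‖ / η
  set u := ‖avg s.1 - wstar‖ / η
  set v := ‖s.2.2.1‖
  calc ‖H s.2.1‖ ^ 2 ≤ (x + y + u + v) ^ 2 := by gcongr
    _ ≤ _ := by
      nlinarith [sq_nonneg (x - y), sq_nonneg (x - u), sq_nonneg (x - v), sq_nonneg (y - u),
        sq_nonneg (y - v), sq_nonneg (u - v)]

variable {Ω : Type*} [mΩ : MeasurableSpace Ω] [MeasurableSpace Ξ] {Pr : Measure Ω}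

/-- The mean squared error of the averaged iterate, in terms of the second moments of the final
error, of the accumulated noise and of the accumulated curvature terms. -/
theorem integral_sqError_le [IsProbabilityMeasure Pr] (hP : 1 ≤ P) {C : ℕ} {N : ℕ → ℕ}
    {Z : ℕ → ℕ → Fin P → Ω → Ξ} {ℱ : ℕ → ℕ → MeasurableSpace Ω} {F : Vec d → ℝ}
    (hX : 0 < totalSteps N C) (hη : 0 < η) (hH : ∀ v, ‖v - η • H v‖ ≤ ‖v‖)
    (hF : hess F wstar = H)
    (hf : ∀ w : Fin P → Vec d, ‖H (avg w - wstar) - avg (fun p => f (w p))‖ ≤ c * U w)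
    (hfm : Measurable f) (hU : Measurable U) (hG : Measurable (Function.uncurry G))
    (hZ : AdaptedInputs Pr C N (fun t k ω p => Z t k p ω) ℱ) {b₁ b₂ b₃ : ℝ}
    (hb₁ : 0 ≤ b₁) (hb₂ : 0 ≤ b₂) (hb₃ : 0 ≤ b₃)
    (h₁ : ∫⁻ ω, ENNReal.ofReal (‖avg (chainSync (sgdStep η f U wstar G) sgdSync N
      (fun t k p => Z t k p ω) ((fun _ => w₀, 0, 0, 0) : State d P) C).1 - wstar‖ ^ 2) ∂Pr
        ≤ ENNReal.ofReal b₁)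
    (h₂ : ∫⁻ ω, ENNReal.ofReal (‖(chainSync (sgdStep η f U wstar G) sgdSync N
      (fun t k p => Z t k p ω) ((fun _ => w₀, 0, 0, 0) : State d P) C).2.2.1‖ ^ 2) ∂Pr
        ≤ ENNReal.ofReal b₂)
    (h₃ : ∫⁻ ω, ENNReal.ofReal ((chainSync (sgdStep η f U wstar G) sgdSync N
      (fun t k p => Z t k p ω) ((fun _ => w₀, 0, 0, 0) : State d P) C).2.2.2 ^ 2) ∂Pr
        ≤ ENNReal.ofReal b₃) :
    Integrable (sqError F wstar w₀ η C N G Z) Pr ∧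
      ∫ ω, sqError F wstar w₀ η C N G Z ω ∂Pr ≤ 4 / (totalSteps N C : ℝ) ^ 2 *
        (‖w₀ - wstar‖ ^ 2 / η ^ 2 + b₁ / η ^ 2 + b₂ + c ^ 2 * b₃) := by
  have : NeZero P := ⟨by omega⟩
  set X : ℝ := (totalSteps N C : ℝ) with hXdef
  have hX0 : 0 < X := Nat.cast_pos.mpr hX
  set s : Ω → State d P := fun ω => chainSync (sgdStep η f U wstar G) sgdSync N
    (fun t k p => Z t k p ω) (fun _ => w₀, 0, 0, 0) C with hs
  have hsm : Measurable s := (measurable_chainSync (measurable_sgdStep η hfm hU wstar hG)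
    measurable_sgdSync hZ _ C le_rfl).mono (hZ.le _ _) le_rfl
  have hsi : ∀ p, Measurable fun ω => (s ω).1 p := fun p =>
    (measurable_pi_apply p).comp hsm.fst
  have havg : Measurable fun ω => avg (s ω).1 := measurable_avg hsi
  obtain ⟨i₁, e₁⟩ := integrable_of_lintegral_le (f := fun ω => ‖avg (s ω).1 - wstar‖ ^ 2)
    ((havg.sub_const _).norm.pow_const 2) (fun _ => by positivity) hb₁ h₁
  obtain ⟨i₂, e₂⟩ := integrable_of_lintegral_le (f := fun ω => ‖(s ω).2.2.1‖ ^ 2)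
    (hsm.snd.snd.fst.norm.pow_const 2) (fun _ => by positivity) hb₂ h₂
  obtain ⟨i₃, e₃⟩ := integrable_of_lintegral_le (f := fun ω => (s ω).2.2.2 ^ 2)
    (hsm.snd.snd.snd.pow_const 2) (fun _ => by positivity) hb₃ h₃
  have hsq : ∀ ω, sqError F wstar w₀ η C N G Z ω = (X ^ 2)⁻¹ * ‖H (s ω).2.1‖ ^ 2 := fun ω => by
    rw [sqError, polyakRuppert_sub η f U wstar G hP hX, hF, map_smul, norm_smul, norm_inv, mul_pow,
      inv_pow, Real.norm_of_nonneg hX0.le]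
  set g : Ω → ℝ := fun ω => 4 / X ^ 2 * (‖w₀ - wstar‖ ^ 2 / η ^ 2
    + ‖avg (s ω).1 - wstar‖ ^ 2 / η ^ 2 + ‖(s ω).2.2.1‖ ^ 2 + c ^ 2 * (s ω).2.2.2 ^ 2) with hg
  have j₁ : Integrable (fun ω => ‖w₀ - wstar‖ ^ 2 / η ^ 2 + ‖avg (s ω).1 - wstar‖ ^ 2 / η ^ 2) Pr :=
    (integrable_const _).add (i₁.div_const _)
  have j₂ : Integrable (fun ω => ‖w₀ - wstar‖ ^ 2 / η ^ 2 + ‖avg (s ω).1 - wstar‖ ^ 2 / η ^ 2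
    + ‖(s ω).2.2.1‖ ^ 2) Pr := j₁.add i₂
  have hgi : Integrable g Pr := (j₂.add (i₃.const_mul _)).const_mul _
  have hle : ∀ ω, sqError F wstar w₀ η C N G Z ω ≤ g ω := fun ω => by
    rw [hsq]
    simp only [hg]
    rw [div_mul_eq_mul_div, ← div_eq_inv_mul]
    gcongr
    exact norm_sq_sum_le hη hH hf N _ C (s ω) rfl
  have hsqi : Integrable (sqError F wstar w₀ η C N G Z) Pr := by
    refine hgi.mono' ?_ (ae_of_all _ fun ω => ?_)
    · rw [funext hsq]
      exact (((H.measurable.comp hsm.snd.fst).norm.pow_const 2).const_mul _).aestronglyMeasurable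
    · rw [Real.norm_of_nonneg (by unfold sqError; positivity)]
      exact hle ω
  refine ⟨hsqi, (integral_mono hsqi hgi hle).trans ?_⟩
  rw [hg, integral_const_mul, integral_add j₂ (i₃.const_mul _), integral_add j₁ i₂,
    integral_add (integrable_const _) (i₁.div_const _), integral_const_mul]
  simp only [integral_div, integral_const, probReal_univ, one_smul]
  gcongr

end Error

/-! ### Gradient steps of co-coercive linear maps -/

section Cocoercive

variable {d : ℕ} {A : Vec d →L[ℝ] Vec d} {μ L η : ℝ}

lemma norm_sq_sub_smul_le (hA : ∀ v, ‖A v‖ ^ 2 ≤ L * inner ℝ (A v) v) (v : Vec d) :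
    ‖v - η • A v‖ ^ 2 ≤ ‖v‖ ^ 2 - η * (2 - η * L) * inner ℝ (A v) v := by
  rw [norm_sub_sq_real, inner_smul_right, norm_smul, mul_pow, Real.norm_eq_abs, sq_abs,
    real_inner_comm]
  have := mul_le_mul_of_nonneg_left (hA v) (sq_nonneg η)
  linarith

/-- Since `2 - η L ≥ 1`, the squared norm shrinks by the factor `1 - η μ`, which is at most `(1 - η
μ / 2)²`. -/
lemma norm_sub_smul_le (hA : ∀ v, ‖A v‖ ^ 2 ≤ L * inner ℝ (A v) v)
    (hμ : ∀ v, μ * ‖v‖ ^ 2 ≤ inner ℝ (A v) v) (hμ0 : 0 ≤ μ) (hη : 0 ≤ η) (hL : 2 * η * L ≤ 1)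
    (hημ : η * μ ≤ 1) (v : Vec d) : ‖v - η • A v‖ ≤ (1 - η * μ / 2) * ‖v‖ := by
  refine le_of_sq_le_sq ?_ (mul_nonneg (by linarith) (norm_nonneg v))
  refine (norm_sq_sub_smul_le hA v).trans ?_
  have h0 : 0 ≤ inner ℝ (A v) v := le_trans (by positivity) (hμ v)
  have h1 : η * (μ * ‖v‖ ^ 2) ≤ η * inner ℝ (A v) v := mul_le_mul_of_nonneg_left (hμ v) hη
  have h2 : η * inner ℝ (A v) v ≤ η * (2 - η * L) * inner ℝ (A v) v := by
    have : η * 1 ≤ η * (2 - η * L) := mul_le_mul_of_nonneg_left (by linarith) hη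
    nlinarith
  nlinarith [sq_nonneg (η * μ * ‖v‖)]

end Cocoercive

/-! ### Variances -/

section Variance

variable {Ω : Type*} [MeasurableSpace Ω] {Pr : Measure Ω} [IsProbabilityMeasure Pr]
  {E : Type*} [NormedAddCommGroup E] [InnerProductSpace ℝ E] [CompleteSpace E]

lemma integrable_integral_norm_sub_sq {f : Ω → E} {c : E} (hf : Integrable f Pr)
    (hf2 : Integrable (fun ω => ‖f ω‖ ^ 2) Pr) (hc : ∫ ω, f ω ∂Pr = c) :
    Integrable (fun ω => ‖f ω - c‖ ^ 2) Pr ∧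
      ∫ ω, ‖f ω - c‖ ^ 2 ∂Pr = ∫ ω, ‖f ω‖ ^ 2 ∂Pr - ‖c‖ ^ 2 := by
  have h1 : ∀ ω, ‖f ω - c‖ ^ 2 = ‖f ω‖ ^ 2 - 2 * inner ℝ c (f ω) + ‖c‖ ^ 2 := fun ω => by
    rw [norm_sub_sq_real, real_inner_comm]
  have hi : Integrable (fun ω => 2 * inner ℝ c (f ω)) Pr := (hf.const_inner c).const_mul 2
  have hs : Integrable (fun ω => ‖f ω‖ ^ 2 - 2 * inner ℝ c (f ω)) Pr := hf2.sub hi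
  simp only [h1]
  refine ⟨hs.add (integrable_const _), ?_⟩
  rw [integral_add hs (integrable_const _), integral_sub hf2 hi, integral_const_mul,
    integral_inner hf, hc, real_inner_self_eq_norm_sq]
  simp
  ring

lemma norm_sq_integral_le {f : Ω → E} {c : E} (hf : Integrable f Pr)
    (hf2 : Integrable (fun ω => ‖f ω‖ ^ 2) Pr) (hc : ∫ ω, f ω ∂Pr = c) :
    ‖c‖ ^ 2 ≤ ∫ ω, ‖f ω‖ ^ 2 ∂Pr := by
  have h1 := (integrable_integral_norm_sub_sq hf hf2 hc).2
  have h2 : 0 ≤ ∫ ω, ‖f ω - c‖ ^ 2 ∂Pr := integral_nonneg fun ω => by positivity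
  linarith

lemma integrable_sq_of_fourth_moment {d : ℕ} {f : Ω → Vec d} {σ : ℝ} (hf : AEStronglyMeasurable f Pr)
    (h4 : Integrable (fun ω => ‖f ω‖ ^ 4) Pr) (hσ : ∫ ω, ‖f ω‖ ^ 4 ∂Pr ≤ σ ^ 4) :
    Integrable (fun ω => ‖f ω‖ ^ 2) Pr ∧ ∫ ω, ‖f ω‖ ^ 2 ∂Pr ≤ σ ^ 2 := by
  have hi : Integrable (fun ω => ‖f ω‖ ^ 2) Pr := by
    refine ((integrable_const (1 : ℝ)).add h4).mono' (hf.norm.pow 2) (ae_of_all _ fun ω => ?_)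
    rw [Real.norm_of_nonneg (by positivity)]
    simp only [Pi.add_apply]
    nlinarith [sq_nonneg (‖f ω‖ ^ 2 - 1)]
  have h4' : ∀ ω, ‖‖f ω‖ ^ 2‖ ^ 2 = ‖f ω‖ ^ 4 := fun ω => by
    rw [Real.norm_of_nonneg (by positivity)]; ring
  have h := norm_sq_integral_le hi (by simpa only [h4'] using h4) rfl
  simp only [h4'] at h
  refine ⟨hi, ?_⟩
  rw [Real.norm_eq_abs, sq_abs] at h
  exact le_of_sq_le_sq ((h.trans hσ).trans_eq (by ring)) (by positivity)

end Variance

/-! ### The mini-batch rate -/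

/-- The bounds obtained below involve only these terms of the rate; the others are nonnegative. -/
lemma le_miniBatchRate {μ L M η σ r : ℝ} {P X : ℕ} (hμ : 0 < μ) (hη : 0 < η) :
    r ^ 2 / (η ^ 2 * X ^ 2) * (1 + M ^ 2 / μ ^ 2 * r ^ 2)
      + σ ^ 2 / (P * X) * (1 + Q2var μ M η σ P X / P ^ 2) ≤ miniBatchRate μ L M η σ r P X := by
  unfold miniBatchRate Qbias Q1var
  have h1 : 0 ≤ L ^ 2 * η / (μ * P) := by positivity
  have h2 : 0 ≤ (L ^ 2 * η / μ + P / (X * η * μ)) / P := by positivity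
  exact add_le_add (mul_le_mul_of_nonneg_left (by linarith) (by positivity))
    (mul_le_mul_of_nonneg_left (by linarith) (by positivity))

/-! ### The quadratic case -/

section Quadratic

variable {d P C : ℕ} {N : ℕ → ℕ} {Ω Ξ : Type*} [mΩ : MeasurableSpace Ω] [MeasurableSpace Ξ]
  {Pr : Measure Ω} {F : Vec d → ℝ} {S : Matrix (Fin d) (Fin d) ℝ} {wstar w₀ : Vec d}
  {G : Ξ → Vec d → Vec d} {Z : ℕ → ℕ → Fin P → Ω → Ξ} {μ L η σ : ℝ}

/-- The continuous linear map of a matrix. -/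
def matrixMap (S : Matrix (Fin d) (Fin d) ℝ) : Vec d →L[ℝ] Vec d :=
  (Matrix.toEuclideanLin S).toContinuousLinearMap

lemma IsQuadratic.gradient_eq (h : IsQuadratic F wstar S) (w : Vec d) :
    gradient F w = matrixMap S (w - wstar) := by
  have hsymm : (Matrix.toEuclideanLin S).IsSymmetric :=
    (Matrix.isPositive_toEuclideanLin_iff.mpr h.1.posSemidef).isSymmetric
  have hF : F = fun w => 2⁻¹ * inner ℝ (w - wstar) (matrixMap S (w - wstar)) :=
    funext fun w => (h.2 w).trans (div_eq_inv_mul _ _)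
  have h1 : HasFDerivAt (fun w => w - wstar) (ContinuousLinearMap.id ℝ (Vec d)) w :=
    (hasFDerivAt_id w).sub_const wstar
  have h2 := (h1.inner ℝ ((matrixMap S).hasFDerivAt.comp w h1)).const_mul 2⁻¹
  refine HasGradientAt.gradient ?_
  rw [hasGradientAt_iff_hasFDerivAt, hF]
  refine h2.congr_fderiv ?_
  ext v
  have h3 : inner ℝ (matrixMap S v) (w - wstar) = inner ℝ v (matrixMap S (w - wstar)) :=
    hsymm v (w - wstar)
  simp only [smul_apply, ContinuousLinearMap.comp_apply,
    ContinuousLinearMap.prod_apply, ContinuousLinearMap.id_apply, fderivInnerCLM_apply,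
    Function.comp_apply, InnerProductSpace.toDual_apply_apply, smul_eq_mul]
  rw [real_inner_comm, h3, real_inner_comm v]
  ring

lemma IsQuadratic.hess_eq (h : IsQuadratic F wstar S) : hess F wstar = matrixMap S := by
  have h1 : gradient F = fun w => matrixMap S (w - wstar) := funext h.gradient_eq
  rw [hess, h1]
  exact ((matrixMap S).hasFDerivAt.comp wstar ((hasFDerivAt_id wstar).sub_const wstar)).fderiv

lemma SpectrumBetween.pos (hd : 0 < d) (hS : S.PosDef) (h : SpectrumBetween S μ L) (hμ : 0 < μ) :
    0 < L :=
  have h1 := h _ (hS.isHermitian.eigenvalues_mem_spectrum_real ⟨0, hd⟩)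
  hμ.trans_le (h1.1.trans h1.2)

/-- Averaging the pointwise inequality bounds the second moment of the increment of the field;
Jensen then makes the mean field co-coercive as well. -/
lemma GradientOracle.cocoercive_mean [IsProbabilityMeasure Pr] (hquad : IsQuadratic F wstar S)
    (h : GradientOracle Pr F C N G Z) (hco : Cocoercive Pr C N G Z L) (i : StepIndex C N P)
    (w : Vec d) :
    (Integrable (fun ω => ‖field G Z i w ω - field G Z i wstar ω‖ ^ 2) Pr ∧
      ∫ ω, ‖field G Z i w ω - field G Z i wstar ω‖ ^ 2 ∂Pr
        ≤ L * inner ℝ (matrixMap S (w - wstar)) (w - wstar)) ∧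
    ‖matrixMap S (w - wstar)‖ ^ 2 ≤ L * inner ℝ (matrixMap S (w - wstar)) (w - wstar) := by
  have hD : Integrable (fun ω => field G Z i w ω - field G Z i wstar ω) Pr :=
    (h.integrable i w).sub (h.integrable i wstar)
  have hDi : ∫ ω, (field G Z i w ω - field G Z i wstar ω) ∂Pr = matrixMap S (w - wstar) := by
    rw [integral_sub (h.integrable i w) (h.integrable i wstar), h.integral_field,
      h.integral_field, hquad.gradient_eq, hquad.gradient_eq, sub_self, map_zero, sub_zero]
  have hI : Integrable (fun ω => L * inner ℝ (field G Z i w ω - field G Z i wstar ω)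
      (w - wstar)) Pr := (hD.inner_const _).const_mul L
  have hle := (hco i).mono fun ω hω => hω w wstar
  have hD2 : Integrable (fun ω => ‖field G Z i w ω - field G Z i wstar ω‖ ^ 2) Pr := by
    refine hI.mono' (hD.1.norm.pow 2) (hle.mono fun ω hω => ?_)
    rwa [Real.norm_of_nonneg (by positivity)]
  have hint : ∫ ω, ‖field G Z i w ω - field G Z i wstar ω‖ ^ 2 ∂Pr
      ≤ L * inner ℝ (matrixMap S (w - wstar)) (w - wstar) := by
    refine (integral_mono_ae hD2 hI hle).trans_eq ?_
    rw [integral_const_mul]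
    congr 1
    simp only [real_inner_comm (w - wstar)]
    rw [integral_inner hD, hDi]
  exact ⟨⟨hD2, hint⟩, (norm_sq_integral_le hD hD2 hDi).trans hint⟩

lemma GradientOracle.noise_quadratic [IsProbabilityMeasure Pr] (hquad : IsQuadratic F wstar S)
    (h : GradientOracle Pr F C N G Z) (hco : Cocoercive Pr C N G Z L)
    (h4 : FourthMomentAt Pr C N G Z wstar σ) (i : StepIndex C N P) (w : Vec d) :
    Integrable (fun ω => ‖field G Z i w ω - gradient F w‖ ^ 2) Pr ∧
      ∫ ω, ‖field G Z i w ω - gradient F w‖ ^ 2 ∂Pr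
        ≤ 2 * L * inner ℝ (matrixMap S (w - wstar)) (w - wstar) + 2 * σ ^ 2 := by
  obtain ⟨⟨hD2, hD⟩, -⟩ := h.cocoercive_mean hquad hco i w
  obtain ⟨hs2, hs⟩ := integrable_sq_of_fourth_moment (h.integrable i wstar).1 (h4 i).1 (h4 i).2
  have hle : ∀ ω, ‖field G Z i w ω‖ ^ 2 ≤ 2 * ‖field G Z i w ω - field G Z i wstar ω‖ ^ 2
      + 2 * ‖field G Z i wstar ω‖ ^ 2 := fun ω => by
    have h1 := norm_add_le (field G Z i w ω - field G Z i wstar ω) (field G Z i wstar ω)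
    rw [sub_add_cancel] at h1
    have h2 := pow_le_pow_left₀ (norm_nonneg _) h1 2
    nlinarith [sq_nonneg (‖field G Z i w ω - field G Z i wstar ω‖ - ‖field G Z i wstar ω‖)]
  have hb := (hD2.const_mul 2).add (hs2.const_mul 2)
  have hg2 : Integrable (fun ω => ‖field G Z i w ω‖ ^ 2) Pr := by
    refine hb.mono' ((h.integrable i w).1.norm.pow 2) (ae_of_all _ fun ω => ?_)
    rw [Real.norm_of_nonneg (by positivity)]
    exact hle ω
  obtain ⟨hv, hv2⟩ := integrable_integral_norm_sub_sq (h.integrable i w) hg2 (h.integral_field i w)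
  refine ⟨hv, hv2.trans_le ?_⟩
  have h3 : ∫ ω, ‖field G Z i w ω‖ ^ 2 ∂Pr ≤ _ := integral_mono hg2 hb hle
  simp only [Pi.add_apply] at h3
  rw [integral_add (hD2.const_mul 2) (hs2.const_mul 2), integral_const_mul,
    integral_const_mul] at h3
  nlinarith [sq_nonneg ‖gradient F w‖]

/-- One step of the mean squared error and of the accumulated noise, for a linear gradient field
and a noise whose variance is controlled by the gradient. -/
lemma meanLE_quadratic_step [NeZero P] [IsProbabilityMeasure Pr] {A : Vec d →L[ℝ] Vec d}
    (hL : 0 < L) (hη : 0 < η) (hηL : 2 * η * L ≤ 1)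
    (hA : ∀ v, ‖A v‖ ^ 2 ≤ L * inner ℝ (A v) v) {ξ : Fin P → Ω → Vec d} {e : Fin P → Vec d}
    (hξ : Noise Pr ξ fun p => 2 * L * inner ℝ (A (e p)) (e p) + 2 * σ ^ 2) (x : Vec d) (c : ℝ) :
    MeanLE Pr (fun ω => ‖x + c • avg (fun p => ξ p ω)‖ ^ 2
        + c ^ 2 * (4 * L / (η * P) * avg (fun p => ‖(e p - η • A (e p)) + (-η) • ξ p ω‖ ^ 2)))
      (‖x‖ ^ 2 + c ^ 2 * (4 * L / (η * P) * avg (fun p => ‖e p‖ ^ 2) + 6 * σ ^ 2 / P)) := by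
  have hP : (0 : ℝ) < P := Nat.cast_pos.mpr (NeZero.pos P)
  have ha : ∀ p, 0 ≤ inner ℝ (A (e p)) (e p) := fun p => by
    have := (sq_nonneg _).trans (hA (e p))
    exact nonneg_of_mul_nonneg_right this hL
  have h1 := hξ.meanLE_avg gauge_norm_sq x c
  -- The decrease `η (2 - η L)` minus the noise contribution `2 η² L` is at least `η / 2`, because
  -- `2 η L ≤ 1`.
  have h2 : MeanLE Pr (fun ω => avg fun p => ‖(e p - η • A (e p)) + (-η) • ξ p ω‖ ^ 2)
      (avg fun p => ‖e p‖ ^ 2 - η / 2 * inner ℝ (A (e p)) (e p) + 2 * η ^ 2 * σ ^ 2) := by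
    refine MeanLE.avg fun p => (hξ.meanLE_single gauge_norm_sq (e p - η • A (e p)) (-η) p).mono
      (fun _ => le_rfl) ?_
    have h3 := norm_sq_sub_smul_le (η := η) hA (e p)
    have h4 := mul_nonneg hη.le (ha p)
    have h5 := mul_le_mul_of_nonneg_right hηL h4
    nlinarith
  have hβ : 0 ≤ 4 * L / (η * P) := by positivity
  refine (h1.add ((h2.const_mul hβ).const_mul (sq_nonneg c))).mono (fun _ => le_rfl) ?_
  have e1 : avg (fun p : Fin P => 2 * L * inner ℝ (A (e p)) (e p) + 2 * σ ^ 2)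
      = 2 * L * avg (fun p : Fin P => inner ℝ (A (e p)) (e p)) + 2 * σ ^ 2 := by
    rw [avg_add, avg_mul, avg_const]
  have e2 : avg (fun p => ‖e p‖ ^ 2 - η / 2 * inner ℝ (A (e p)) (e p) + 2 * η ^ 2 * σ ^ 2)
      = avg (fun p => ‖e p‖ ^ 2) - η / 2 * avg (fun p : Fin P => inner ℝ (A (e p)) (e p))
        + 2 * η ^ 2 * σ ^ 2 := by
    rw [avg_add, avg_sub, avg_mul, avg_const]
  rw [e1, e2]
  set a := avg fun p : Fin P => inner ℝ (A (e p)) (e p)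
  set b := avg fun p => ‖e p‖ ^ 2
  -- The weight `4 L / (η P)` is chosen so that the two multiples of `a` cancel exactly.
  have e3 : (P : ℝ)⁻¹ * (2 * L * a + 2 * σ ^ 2)
      + 4 * L / (η * P) * (b - η / 2 * a + 2 * η ^ 2 * σ ^ 2)
      = 4 * L / (η * P) * b + (2 + 4 * (2 * η * L)) * σ ^ 2 / P := by
    field_simp; ring
  have e4 : (2 + 4 * (2 * η * L)) * σ ^ 2 / P ≤ 6 * σ ^ 2 / P := by
    gcongr; linarith
  have := mul_le_mul_of_nonneg_left (e3.trans_le (add_le_add_right e4 _)) (sq_nonneg c)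
  linarith

/-- The quadratic case, in dimension at least one. -/
theorem quadratic_bound [IsProbabilityMeasure Pr] (hd : 0 < d) (hP : 1 ≤ P) (hC : 1 ≤ C)
    (hN : ∀ t ∈ Finset.Icc 1 C, 1 ≤ N t) (hμ : 0 < μ) (hη : 0 < η) (hηL : 2 * η * L ≤ 1)
    (hquad : IsQuadratic F wstar S) (hS : SpectrumBetween S μ L)
    (h : GradientOracle Pr F C N G Z) (hco : Cocoercive Pr C N G Z L)
    (h4 : FourthMomentAt Pr C N G Z wstar σ) :
    Integrable (sqError F wstar w₀ η C N G Z) Pr ∧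
      ∫ ω, sqError F wstar w₀ η C N G Z ω ∂Pr
        ≤ 48 * miniBatchRate μ L 0 η σ ‖w₀ - wstar‖ P (totalSteps N C) := by
  have : NeZero P := ⟨by omega⟩
  have hP0 : (1 : ℝ) ≤ P := by exact_mod_cast hP
  have hL : 0 < L := hS.pos hd hquad.1 hμ
  have hN1 : 0 < N (0 + 1) := hN 1 (by simp [hC])
  have hX : 0 < totalSteps N C := lt_of_lt_of_le (by rw [totalSteps_succ]; omega)
    (totalSteps_mono N hC : totalSteps N (0 + 1) ≤ totalSteps N C)
  have hX0 : (0 : ℝ) < totalSteps N C := Nat.cast_pos.mpr hX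
  set A := matrixMap S
  have hA : ∀ v, ‖A v‖ ^ 2 ≤ L * inner ℝ (A v) v := fun v => by
    simpa using (h.cocoercive_mean hquad hco (stepIndex hC hN1 ⟨0, hP⟩) (wstar + v)).2
  have hA0 : ∀ v, 0 * ‖v‖ ^ 2 ≤ inner ℝ (A v) v := fun v => by
    rw [zero_mul]
    exact nonneg_of_mul_nonneg_right ((sq_nonneg _).trans (hA v)) hL
  have hH : ∀ v, ‖v - η • A v‖ ≤ ‖v‖ := fun v => by
    simpa using norm_sub_smul_le hA hA0 le_rfl hη.le hηL (by simp) v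
  set f : Vec d → Vec d := fun w => A (w - wstar) with hf
  have hgrad : gradient F = f := funext hquad.gradient_eq
  have hfm : Measurable f := A.continuous.measurable.comp (measurable_id.sub_const wstar)
  set β : ℝ := 4 * L / (η * P) with hβ
  have hβ0 : 0 ≤ β := by positivity
  set c : ℝ := 6 * σ ^ 2 / P with hc
  have hc0 : 0 ≤ c := by positivity
  set r : ℝ := ‖w₀ - wstar‖ with hr
  set step := sgdStep (P := P) η f (fun _ => 0) wstar G with hstepdef
  have hstepm : Measurable (Function.uncurry step) :=
    measurable_sgdStep η hfm measurable_const wstar h.measurable_field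
  have hnoise : ∀ t k (ht : t < C) (hk : k < N (t + 1)) (w : Fin P → Vec d),
      Noise Pr (fun p ω => G (Z (t + 1) (k + 1) p ω) (w p) - f (w p))
        fun p => 2 * L * inner ℝ (A (w p - wstar)) (w p - wstar) + 2 * σ ^ 2 := by
    intro t k ht hk w
    rw [← hgrad]
    exact h.noise ht hk w fun p => h.noise_quadratic hquad hco h4 _ _
  have hE2 : Measurable fun s : State d P => avg fun p => ‖s.1 p - wstar‖ ^ 2 :=
    measurable_avg fun p => by fun_prop
  have havg : Measurable fun s : State d P => avg s.1 := measurable_avg fun p => by fun_prop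
  have hstate : ∀ (s : State d P) z p, (step s z).1 p - wstar
      = ((s.1 p - wstar) - η • A (s.1 p - wstar)) + (-η) • (G (z p) (s.1 p) - f (s.1 p)) := by
    intro s z p
    simp only [hstepdef, sgdStep, hf]
    module
  have hmean : ∀ (s : State d P) z, avg (step s z).1 - wstar
      = ((avg s.1 - wstar) - η • A (avg s.1 - wstar))
        + (-η) • avg (fun p => G (z p) (s.1 p) - f (s.1 p)) := by
    intro s z
    have h1 : avg (fun p => (step s z).1 p - wstar) = avg (step s z).1 - wstar := by
      rw [avg_sub, avg_const]
    have h2 : avg (fun p => s.1 p - wstar) = avg s.1 - wstar := by rw [avg_sub, avg_const]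
    have h3 := map_avg (A : Vec d →ₗ[ℝ] Vec d) fun p => s.1 p - wstar
    simp only [ContinuousLinearMap.coe_coe] at h3
    rw [← h1]
    simp only [hstate]
    rw [avg_add, avg_sub, avg_smul, avg_smul, ← h3, h2]
  have hsyncE : ∀ s : State d P, ‖avg s.1 - wstar‖ ^ 2 ≤ avg fun p => ‖s.1 p - wstar‖ ^ 2 := by
    intro s
    have h2 : avg (fun p => s.1 p - wstar) = avg s.1 - wstar := by rw [avg_sub, avg_const]
    rw [← h2]
    exact convexOn_map_avg_le convexOn_norm_sq _
  have hb : 0 ≤ β * r ^ 2 + totalSteps N C * c := by positivity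
  -- The final error is moved by `-η` times the noise, whence the factor `(-η) ^ 2`; the accumulated
  -- noise in `B₂` is the same computation with factor `1`.
  have B₁ := lintegral_chainSync_le hstepm measurable_sgdSync h.adaptedInputs
    (V := fun R _ s => ‖avg s.1 - wstar‖ ^ 2
      + (-η) ^ 2 * (β * avg (fun p => ‖s.1 p - wstar‖ ^ 2) + R * c))
    (s := (fun _ => w₀, 0, 0, 0)) (v := r ^ 2 + η ^ 2 * (β * r ^ 2 + totalSteps N C * c))
    (fun R n => ((havg.sub_const _).norm.pow_const 2).add
      (((hE2.const_mul _).add_const _).const_mul _))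
    (fun R n s => by
      have := avg_nonneg (x := fun p => ‖s.1 p - wstar‖ ^ 2) fun p => by positivity
      positivity)
    (fun n => by simp only [avg_const, neg_sq]; exact le_rfl)
    (fun R n s => by
      simp only [sgdSync, avg_const]
      gcongr
      exact hsyncE s)
    (fun t k R n ht hk _ _ s => by
      have hq := (meanLE_quadratic_step hL hη hηL hA (hnoise t k ht hk s.1)
        ((avg s.1 - wstar) - η • A (avg s.1 - wstar)) (-η)).add (MeanLE.const (η ^ 2 * (R * c)))
      refine hq.mono (fun ω => ?_) ?_
      · simp only [hstate, hmean]
        rw [← hβ]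
        linarith
      · have := pow_le_pow_left₀ (norm_nonneg _) (hH (avg s.1 - wstar)) 2
        push_cast
        linarith)
  have B₂ := lintegral_chainSync_le hstepm measurable_sgdSync h.adaptedInputs
    (V := fun R _ s => ‖s.2.2.1‖ ^ 2 + (β * avg (fun p => ‖s.1 p - wstar‖ ^ 2) + R * c))
    (s := (fun _ => w₀, 0, 0, 0)) (v := β * r ^ 2 + totalSteps N C * c)
    (fun R n => (by fun_prop : Measurable fun s : State d P => ‖s.2.2.1‖ ^ 2).add
      ((hE2.const_mul _).add_const _))
    (fun R n s => by
      have := avg_nonneg (x := fun p => ‖s.1 p - wstar‖ ^ 2) fun p => by positivity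
      positivity)
    (fun n => by simp [avg_const, hr])
    (fun R n s => by
      simp only [sgdSync, avg_const]
      gcongr
      exact hsyncE s)
    (fun t k R n ht hk _ _ s => by
      have hq := (meanLE_quadratic_step hL hη hηL hA (hnoise t k ht hk s.1)
        s.2.2.1 1).add (MeanLE.const (R * c))
      refine hq.mono (fun ω => ?_) ?_
      · simp only [hstate]
        simp only [hstepdef, sgdStep, one_smul, one_pow, one_mul]
        rw [← hβ]
        linarith
      · push_cast
        linarith)
  have B₃ := lintegral_chainSync_le hstepm measurable_sgdSync h.adaptedInputs
    (V := fun _ _ s => s.2.2.2 ^ 2) (s := (fun _ => w₀, 0, 0, 0)) (v := 0)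
    (fun R n => by fun_prop) (fun R n s => by positivity) (fun n => by simp)
    (fun R n s => le_rfl)
    (fun t k R n ht hk _ _ s => by
      simp only [hstepdef, sgdStep, add_zero]
      exact MeanLE.const _)
  have hres := integral_sqError_le (c := 0) hP hX hη hH hquad.hess_eq (f := f) (U := fun _ => 0)
    (w₀ := w₀) (fun w => by
      have h2 : avg (fun p => w p - wstar) = avg w - wstar := by rw [avg_sub, avg_const]
      have h3 := map_avg (A : Vec d →ₗ[ℝ] Vec d) fun p => w p - wstar
      simp only [ContinuousLinearMap.coe_coe] at h3
      rw [← h2, h3]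
      simp [hf]) hfm measurable_const h.measurable_field h.adaptedInputs
    (b₁ := r ^ 2 + η ^ 2 * (β * r ^ 2 + totalSteps N C * c))
    (b₂ := β * r ^ 2 + totalSteps N C * c) (b₃ := 0) (by positivity) hb le_rfl
    (le_trans (lintegral_mono fun ω => ENNReal.ofReal_le_ofReal (by
      have := avg_nonneg (x := fun p => ‖(chainSync step sgdSync N (fun t k p => Z t k p ω)
        ((fun _ => w₀, 0, 0, 0) : State d P) C).1 p - wstar‖ ^ 2) fun p => by positivity
      simp only [Nat.cast_zero, zero_mul, add_zero]
      exact le_add_of_nonneg_right (by positivity))) B₁)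
    (le_trans (lintegral_mono fun ω => ENNReal.ofReal_le_ofReal (by
      have := avg_nonneg (x := fun p => ‖(chainSync step sgdSync N (fun t k p => Z t k p ω)
        ((fun _ => w₀, 0, 0, 0) : State d P) C).1 p - wstar‖ ^ 2) fun p => by positivity
      simp only [Nat.cast_zero, zero_mul, add_zero]
      exact le_add_of_nonneg_right (by positivity))) B₂) B₃
  refine ⟨hres.1, hres.2.trans ?_⟩
  have hrate := le_miniBatchRate (L := L) (M := 0) (σ := σ) (r := r) (P := P)
    (X := totalSteps N C) hμ hη
  have hQ : (0 : ℝ) ≤ Q2var μ 0 η σ P (totalSteps N C) / P ^ 2 := by unfold Q2var; positivity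
  have hβr : β ≤ 2 / η ^ 2 := by
    rw [hβ, div_le_div_iff₀ (by positivity) (by positivity)]
    have : 2 * η * L * η ≤ P * η := by nlinarith
    nlinarith
  generalize (totalSteps N C : ℝ) = X at *
  -- The final error and the accumulated noise contribute `6 σ² X / P` each; the prefactor `4 / X²`
  -- turns this into the constant 48.
  have h5 : 4 / X ^ 2 * (r ^ 2 / η ^ 2 + (r ^ 2 + η ^ 2 * (β * r ^ 2 + X * c)) / η ^ 2
      + (β * r ^ 2 + X * c) + 0 ^ 2 * 0)
      = 8 * (r ^ 2 / (η ^ 2 * X ^ 2)) + 8 * β * r ^ 2 / X ^ 2 + 48 * (σ ^ 2 / (P * X)) := by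
    rw [hc]; field_simp; ring
  have h6 : 8 * β * r ^ 2 / X ^ 2 ≤ 16 * (r ^ 2 / (η ^ 2 * X ^ 2)) := by
    calc 8 * β * r ^ 2 / X ^ 2 ≤ 8 * (2 / η ^ 2) * r ^ 2 / X ^ 2 := by gcongr
      _ = _ := by field_simp; ring
  have h7 : 0 ≤ r ^ 2 / (η ^ 2 * X ^ 2) := by positivity
  have h8 : 0 ≤ σ ^ 2 / (P * X) := by positivity
  have h9 := mul_nonneg h8 hQ
  rw [h5]
  simp only [ne_eq, OfNat.ofNat_ne_zero, not_false_eq_true, zero_pow, zero_div, zero_mul,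
    add_zero, mul_one] at hrate
  nlinarith

end Quadratic

/-! ### Smooth strongly convex functions -/

section Smooth

variable {d : ℕ} {F : Vec d → ℝ} {wstar : Vec d} {μ L M η : ℝ}

lemma SmoothRegular.contDiff_gradient (h : SmoothRegular F L M) : ContDiff ℝ 2 (gradient F) :=
  (InnerProductSpace.toDual ℝ (Vec d)).symm.contDiff.comp (h.1.fderiv_right le_rfl)

lemma SmoothRegular.hasFDerivAt_gradient (h : SmoothRegular F L M) (w : Vec d) :
    HasFDerivAt (gradient F) (hess F w) w :=
  ((h.contDiff_gradient.differentiable (by norm_num)) w).hasFDerivAt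

lemma norm_iteratedFDeriv_gradient (n : ℕ) (w : Vec d) :
    ‖iteratedFDeriv ℝ n (gradient F) w‖ = ‖iteratedFDeriv ℝ (n + 1) F w‖ := by
  rw [← norm_iteratedFDeriv_fderiv]
  exact LinearIsometryEquiv.norm_iteratedFDeriv_comp_left
    (InnerProductSpace.toDual ℝ (Vec d)).symm (fderiv ℝ F) w n

lemma SmoothRegular.norm_hess_le (h : SmoothRegular F L M) (w : Vec d) : ‖hess F w‖ ≤ L := by
  rw [hess, ← norm_iteratedFDeriv_one, norm_iteratedFDeriv_gradient]
  exact h.2.1 w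

lemma SmoothRegular.norm_hess_sub_le (h : SmoothRegular F L M) (w v : Vec d) :
    ‖hess F w - hess F v‖ ≤ M * ‖w - v‖ := by
  have hd : ContDiff ℝ 1 (fderiv ℝ (gradient F)) := h.contDiff_gradient.fderiv_right le_rfl
  refine convex_univ.norm_image_sub_le_of_norm_fderiv_le (𝕜 := ℝ)
    (fun x _ => hd.differentiable (by norm_num) x) (fun x _ => ?_) trivial trivial
  change ‖fderiv ℝ (fderiv ℝ (gradient F)) x‖ ≤ M
  rw [← norm_iteratedFDeriv_one, norm_iteratedFDeriv_fderiv, norm_iteratedFDeriv_gradient]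
  exact h.2.2 x

lemma hess_inner (w u v : Vec d) (h : SmoothRegular F L M) :
    inner ℝ (hess F w u) v = fderiv ℝ (fderiv ℝ F) w u v := by
  have h1 := (InnerProductSpace.toDual ℝ (Vec d)).symm.hasFDerivAt.comp w
    (((h.1.fderiv_right (m := 2) le_rfl).differentiable (by norm_num)) w).hasFDerivAt
  have h2 : hess F w = _ := h1.fderiv
  rw [h2]
  exact InnerProductSpace.toDual_symm_apply

lemma SmoothRegular.hess_symm (h : SmoothRegular F L M) (w u v : Vec d) :
    inner ℝ (hess F w u) v = inner ℝ u (hess F w v) := by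
  rw [hess_inner w u v h, real_inner_comm, hess_inner w v u h]
  exact (h.1.contDiffAt.isSymmSndFDerivAt (by simp; norm_num)).eq u v

lemma gradient_eq_zero_of_isMinOn (h : IsMinOn F Set.univ wstar) : gradient F wstar = 0 := by
  have : IsLocalMin F wstar := h.isLocalMin Filter.univ_mem
  rw [gradient, this.fderiv_eq_zero, map_zero]

/-- On the line through `w` in direction `v`, subtracting `μ / 2 * ‖·‖²` leaves a convex function;
its derivative `φ'` is monotone, so the second derivative at `0` is nonnegative. -/
lemma SmoothRegular.hess_inner_ge (h : SmoothRegular F L M) (hs : StrongConvexOn Set.univ μ F)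
    (w v : Vec d) : μ * ‖v‖ ^ 2 ≤ inner ℝ (hess F w v) v := by
  have hline : ∀ t : ℝ, HasDerivAt (fun t : ℝ => w + t • v) v t := fun t => by
    simpa using ((hasDerivAt_id t).smul_const v).const_add w
  set φ' : ℝ → ℝ := fun t => inner ℝ (gradient F (w + t • v)) v - μ * inner ℝ (w + t • v) v
    with hφ'
  have hF : ∀ x, HasFDerivAt F (InnerProductSpace.toDual ℝ (Vec d) (gradient F x)) x := fun x =>
    ((h.1.differentiable (by norm_num)) x).hasGradientAt.hasFDerivAt
  have hφ : ∀ t, HasDerivAt (fun t : ℝ => F (w + t • v) - μ / 2 * ‖w + t • v‖ ^ 2) (φ' t) t := by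
    intro t
    have h1 := (hF (w + t • v)).comp_hasDerivAt t (hline t)
    have h2 := ((hline t).norm_sq).const_mul (μ / 2)
    refine (h1.sub h2).congr_deriv ?_
    simp only [hφ', InnerProductSpace.toDual_apply_apply]
    ring
  have hconv : ConvexOn ℝ Set.univ fun t : ℝ => F (w + t • v) - μ / 2 * ‖w + t • v‖ ^ 2 := by
    have h1 := (strongConvexOn_iff_convex.mp hs).comp_affineMap (AffineMap.lineMap w (w + v))
    simpa [AffineMap.lineMap_apply, Function.comp_def, add_comm] using h1
  have hmono : Monotone φ' := by
    have h1 := hconv.monotoneOn_deriv fun t _ => (hφ t).differentiableAt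
    rw [funext fun t => (hφ t).deriv] at h1
    exact monotoneOn_univ.mp h1
  have hφ2 : HasDerivAt φ' (inner ℝ (hess F w v) v - μ * inner ℝ v v) 0 := by
    have h0 : HasFDerivAt (gradient F) (hess F w) (w + (0 : ℝ) • v) := by
      simpa using h.hasFDerivAt_gradient w
    have h1 := (h0.comp_hasDerivAt 0 (hline 0)).inner ℝ (hasDerivAt_const (0 : ℝ) v)
    have h2 := ((hline 0).inner ℝ (hasDerivAt_const (0 : ℝ) v)).const_mul μ
    refine (h1.sub h2).congr_deriv ?_
    simp
  have := hφ2.deriv ▸ hmono.deriv_nonneg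
  rw [real_inner_self_eq_norm_sq] at this
  linarith

/-- A positive symmetric operator of norm at most `L` is `L`-co-coercive. -/
lemma cocoercive_of_symm {A : Vec d →L[ℝ] Vec d} (hsymm : ∀ u v, inner ℝ (A u) v = inner ℝ u (A v))
    (hpos : ∀ v, 0 ≤ inner ℝ (A v) v) (hA : ‖A‖ ≤ L) (v : Vec d) :
    ‖A v‖ ^ 2 ≤ L * inner ℝ (A v) v := by
  have hL : 0 ≤ L := (norm_nonneg A).trans hA
  have h1 : inner ℝ (A (A v)) (A v) ≤ L * ‖A v‖ ^ 2 := by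
    calc inner ℝ (A (A v)) (A v) ≤ ‖A (A v)‖ * ‖A v‖ := real_inner_le_norm _ _
      _ ≤ (L * ‖A v‖) * ‖A v‖ := by gcongr; exact A.le_of_opNorm_le hA _
      _ = _ := by ring
  -- Positivity at this vector reads `L² ⟪A v, v⟫ - 2 L ‖A v‖² + ⟪A (A v), A v⟫ ≥ 0`, and `h1`
  -- bounds the last term; it remains to divide by `L`.
  have h2 := hpos (L • v - A v)
  have h3 : inner ℝ (A (A v)) v = ‖A v‖ ^ 2 := by
    rw [hsymm, real_inner_self_eq_norm_sq]
  simp only [map_sub, map_smul, inner_sub_left, inner_sub_right, inner_smul_left,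
    inner_smul_right, conj_trivial, real_inner_self_eq_norm_sq, h3] at h2
  rcases hL.eq_or_lt with h0 | h0
  · have : A v = 0 := by
      have := A.le_of_opNorm_le hA v
      rw [← h0, zero_mul] at this
      exact norm_le_zero_iff.mp this
    simp [this]
  · refine le_of_mul_le_mul_left ?_ h0
    linarith

/-- Mean value inequality: the derivative `1 - η F''` of the step has norm at most `1 - η μ / 2`
everywhere. -/
lemma SmoothRegular.gradient_step_lipschitz (h : SmoothRegular F L M)
    (hs : StrongConvexOn Set.univ μ F) (hμ : 0 ≤ μ) (hη : 0 ≤ η) (hL : 2 * η * L ≤ 1)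
    (hημ : η * μ ≤ 1) (x y : Vec d) :
    ‖(x - η • gradient F x) - (y - η • gradient F y)‖ ≤ (1 - η * μ / 2) * ‖x - y‖ := by
  have hd : ∀ w, HasFDerivAt (fun w => w - η • gradient F w)
      (ContinuousLinearMap.id ℝ (Vec d) - η • hess F w) w := fun w =>
    (hasFDerivAt_id w).sub ((h.hasFDerivAt_gradient w).const_smul η)
  refine convex_univ.norm_image_sub_le_of_norm_fderiv_le (𝕜 := ℝ)
    (f := fun w => w - η • gradient F w) (fun w _ => (hd w).differentiableAt) (fun w _ => ?_)
    trivial trivial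
  rw [(hd w).fderiv]
  refine ContinuousLinearMap.opNorm_le_bound _ (by linarith) fun v => ?_
  have hge := h.hess_inner_ge hs w
  exact norm_sub_smul_le (cocoercive_of_symm (h.hess_symm w)
    (fun v => le_trans (by positivity) (hge v)) (h.norm_hess_le w)) hge hμ hη hL hημ v

lemma SmoothRegular.gradient_lipschitz (h : SmoothRegular F L M) (x y : Vec d) :
    ‖gradient F x - gradient F y‖ ≤ L * ‖x - y‖ :=
  convex_univ.norm_image_sub_le_of_norm_fderiv_le (𝕜 := ℝ)
    (fun w _ => (h.hasFDerivAt_gradient w).differentiableAt) (fun w _ => h.norm_hess_le w)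
    trivial trivial

lemma SmoothRegular.norm_remainder_le (h : SmoothRegular F L M)
    (hmin : IsMinOn F Set.univ wstar) (w : Vec d) :
    ‖hess F wstar (w - wstar) - gradient F w‖ ≤ M * ‖w - wstar‖ ^ 2 := by
  have h1 := (convex_segment wstar w).norm_image_sub_le_of_norm_hasFDerivWithin_le' (𝕜 := ℝ)
    (φ := hess F wstar) (C := M * ‖w - wstar‖)
    (fun x _ => (h.hasFDerivAt_gradient x).hasFDerivWithinAt) (fun x hx => ?_)
    (left_mem_segment ℝ wstar w) (right_mem_segment ℝ wstar w)
  · rw [gradient_eq_zero_of_isMinOn hmin, sub_zero] at h1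
    rw [norm_sub_rev, sq, ← mul_assoc]
    exact h1
  · have hM : 0 ≤ M := (norm_nonneg _).trans (h.2.2 wstar)
    refine (h.norm_hess_sub_le x wstar).trans (mul_le_mul_of_nonneg_left ?_ hM)
    obtain ⟨t, ht, rfl⟩ := (segment_eq_image' ℝ wstar w) ▸ hx
    rw [add_sub_cancel_left, norm_smul, Real.norm_of_nonneg ht.1]
    exact mul_le_of_le_one_left (norm_nonneg _) ht.2

lemma SmoothRegular.norm_remainder_le' (h : SmoothRegular F L M)
    (hmin : IsMinOn F Set.univ wstar) (w : Vec d) :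
    ‖hess F wstar (w - wstar) - gradient F w‖ ≤ 2 * L * ‖w - wstar‖ := by
  have h1 := (hess F wstar).le_of_opNorm_le (h.norm_hess_le wstar) (w - wstar)
  have h2 := h.gradient_lipschitz w wstar
  rw [gradient_eq_zero_of_isMinOn hmin, sub_zero] at h2
  calc _ ≤ _ := norm_sub_le _ _
    _ ≤ L * ‖w - wstar‖ + L * ‖w - wstar‖ := add_le_add h1 h2
    _ = _ := by ring

end Smooth

/-! ### Dispersion of the local iterates -/

section Dispersion

variable {d P : ℕ} {ψ : Vec d → ℝ} {m : ℝ}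

lemma avg_sub_const [NeZero P] (w : Fin P → Vec d) (c : Vec d) :
    avg (fun p => w p - c) = avg w - c := by rw [avg_sub, avg_const]

/-- The mean of a gauge over the pairwise differences of the local iterates. -/
def spread (ψ : Vec d → ℝ) (w : Fin P → Vec d) : ℝ := avg fun p => avg fun q => ψ (w p - w q)

/-- The gauge of the error of the mean iterate, plus the spread of the iterates. -/
def deviation (ψ : Vec d → ℝ) (wstar : Vec d) (w : Fin P → Vec d) : ℝ :=
  ψ (avg w - wstar) + spread ψ w

/-- The Lyapunov function of a phase with `n` remaining steps. -/
def lyapunov (ψ : Vec d → ℝ) (wstar : Vec d) (α γ : ℝ) (n : ℕ) (w : Fin P → Vec d) : ℝ :=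
  α * ψ (avg w - wstar) + γ * n * spread ψ w

lemma Gauge.spread_nonneg (hψ : Gauge ψ m) (w : Fin P → Vec d) : 0 ≤ spread ψ w :=
  avg_nonneg fun _ => avg_nonneg fun _ => hψ.nonneg _

lemma Gauge.deviation_nonneg (hψ : Gauge ψ m) (wstar : Vec d) (w : Fin P → Vec d) :
    0 ≤ deviation ψ wstar w := add_nonneg (hψ.nonneg _) (hψ.spread_nonneg w)

lemma Gauge.lyapunov_nonneg (hψ : Gauge ψ m) (wstar : Vec d) {α γ : ℝ} (hα : 0 ≤ α) (hγ : 0 ≤ γ)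
    (n : ℕ) (w : Fin P → Vec d) : 0 ≤ lyapunov ψ wstar α γ n w :=
  add_nonneg (mul_nonneg hα (hψ.nonneg _)) (mul_nonneg (by positivity) (hψ.spread_nonneg w))

lemma Gauge.measurable_spread (hψ : Gauge ψ m) :
    Measurable (spread ψ : (Fin P → Vec d) → ℝ) :=
  measurable_avg fun p => measurable_avg fun q => hψ.continuous.measurable.comp (by fun_prop)

lemma Gauge.measurable_mean (hψ : Gauge ψ m) (wstar : Vec d) :
    Measurable fun w : Fin P → Vec d => ψ (avg w - wstar) :=
  hψ.continuous.measurable.comp ((measurable_avg fun p => by fun_prop).sub_const _)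

lemma Gauge.measurable_deviation (hψ : Gauge ψ m) (wstar : Vec d) :
    Measurable (deviation ψ wstar : (Fin P → Vec d) → ℝ) :=
  (hψ.measurable_mean wstar).add hψ.measurable_spread

lemma Gauge.measurable_lyapunov (hψ : Gauge ψ m) (wstar : Vec d) (α γ : ℝ) (n : ℕ) :
    Measurable (lyapunov ψ wstar α γ n : (Fin P → Vec d) → ℝ) :=
  ((hψ.measurable_mean wstar).const_mul _).add (hψ.measurable_spread.const_mul _)

/-- Before a step at least one local step is left, so the spread has weight at least one. -/
lemma Gauge.deviation_le_lyapunov {μ η κ : ℝ} (hψ : Gauge ψ m) (hημ0 : 0 < η * μ) (hημ : η * μ ≤ 1)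
    (wstar : Vec d) (w : Fin P → Vec d) (n : ℕ) :
    deviation ψ wstar w ≤ lyapunov ψ wstar (2 / (η * μ)) (1 + 4 * κ ^ 2) (n + 1) w := by
  have h1 : 1 ≤ 2 / (η * μ) := by rw [le_div_iff₀ hημ0]; linarith
  have h2 : (1 : ℝ) ≤ (1 + 4 * κ ^ 2) * ((n + 1 : ℕ) : ℝ) := by
    push_cast
    nlinarith [sq_nonneg κ, (Nat.cast_nonneg n : (0 : ℝ) ≤ n), mul_nonneg (sq_nonneg κ)
      (Nat.cast_nonneg n : (0 : ℝ) ≤ n)]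
  exact add_le_add (le_mul_of_one_le_left (hψ.nonneg _) h1)
    (le_mul_of_one_le_left (hψ.spread_nonneg w) h2)

variable [NeZero P]

lemma Gauge.spread_const (hψ : Gauge ψ m) (c : Vec d) : spread ψ (fun _ : Fin P => c) = 0 := by
  simp [spread, hψ.zero, avg_const]

lemma Gauge.lyapunov_const (hψ : Gauge ψ m) (wstar : Vec d) (α γ : ℝ) (n : ℕ) (c : Vec d) :
    lyapunov ψ wstar α γ n (fun _ : Fin P => c) = α * ψ (c - wstar) := by
  rw [lyapunov, hψ.spread_const, avg_const, mul_zero, add_zero]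

lemma Gauge.avg_sub_avg_le (hψ : Gauge ψ m) (w : Fin P → Vec d) :
    avg (fun p => ψ (w p - avg w)) ≤ spread ψ w := by
  refine avg_mono fun p => ?_
  have : w p - avg w = avg fun q => w p - w q := by rw [avg_sub, avg_const]
  rw [this]
  exact convexOn_map_avg_le hψ.convexOn _

/-- Midpoint convexity at `2 x` and `2 y`, then quadratic growth. -/
lemma Gauge.add_le (hψ : Gauge ψ m) (x y : Vec d) : ψ (x + y) ≤ 2 * ψ x + 2 * ψ y := by
  have h1 := hψ.convexOn.2 (Set.mem_univ ((2 : ℝ) • x)) (Set.mem_univ ((2 : ℝ) • y))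
    (by norm_num : (0 : ℝ) ≤ 1 / 2) (by norm_num : (0 : ℝ) ≤ 1 / 2) (by norm_num)
  have h2 : (1 / 2 : ℝ) • (2 : ℝ) • x + (1 / 2 : ℝ) • (2 : ℝ) • y = x + y := by module
  rw [h2, smul_eq_mul, smul_eq_mul] at h1
  have h3 := hψ.scale 2 x (by norm_num)
  have h4 := hψ.scale 2 y (by norm_num)
  linarith

lemma Gauge.avg_le_deviation (hψ : Gauge ψ m) (wstar : Vec d) (w : Fin P → Vec d) :
    avg (fun p => ψ (w p - wstar)) ≤ 2 * deviation ψ wstar w := by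
  calc avg (fun p => ψ (w p - wstar))
      ≤ avg (fun p => 2 * ψ (avg w - wstar) + 2 * ψ (w p - avg w)) := avg_mono fun p => by
        have := hψ.add_le (avg w - wstar) (w p - avg w)
        rwa [add_comm, sub_add_sub_cancel] at this
    _ = 2 * ψ (avg w - wstar) + 2 * avg (fun p => ψ (w p - avg w)) := by
        rw [avg_add, avg_const, avg_mul]
    _ ≤ _ := by
        rw [deviation]
        linarith [hψ.avg_sub_avg_le w]

/-- At most linear growth of the gauge is what lets squared deviations be controlled by second
moments. -/
lemma Gauge.deviation_sq_le (hψ : Gauge ψ m) (h1 : ∀ x, ψ x ≤ ‖x‖) (wstar : Vec d)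
    (w : Fin P → Vec d) :
    deviation ψ wstar w ^ 2 ≤ 2 * deviation (fun x => ‖x‖ ^ 2) wstar w := by
  have hsq : ∀ x, ψ x ^ 2 ≤ ‖x‖ ^ 2 := fun x => pow_le_pow_left₀ (hψ.nonneg x) (h1 x) 2
  have h2 : spread ψ w ^ 2 ≤ spread (fun x => ‖x‖ ^ 2) w :=
    (sq_avg_le _).trans (avg_mono fun p => (sq_avg_le _).trans (avg_mono fun q => hsq _))
  have h3 := hsq (avg w - wstar)
  rw [deviation, deviation]
  nlinarith [sq_nonneg (ψ (avg w - wstar) - spread ψ w)]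

variable {f : Vec d → Vec d} {wstar : Vec d} {μ L η κ : ℝ}

/-- The mean iterate contracts under a noiseless step, up to the spread of the iterates. -/
lemma Gauge.mean_step_le (hψ : Gauge ψ m) (hμ : 0 < μ) (hη : 0 < η) (hημ : η * μ ≤ 1)
    (hκ : 1 ≤ κ) (hLκ : L ≤ κ * μ) (hf0 : f wstar = 0)
    (hT : ∀ x y, ‖(x - η • f x) - (y - η • f y)‖ ≤ (1 - η * μ / 2) * ‖x - y‖)
    (hfL : ∀ x y, ‖f x - f y‖ ≤ L * ‖x - y‖) (w : Fin P → Vec d) :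
    ψ (avg (fun p => w p - η • f (w p)) - wstar)
      ≤ (1 - η * μ / 2) * ψ (avg w - wstar) + 2 * κ ^ 2 * (η * μ) * spread ψ w := by
  set θ := 1 - η * μ / 2 with hθ
  have hημ0 : 0 < η * μ := mul_pos hη hμ
  have hθ0 : 0 < θ := by rw [hθ]; linarith
  set x := (avg w - η • f (avg w)) - wstar with hx
  set δ := avg fun p => f (w p) - f (avg w) with hδ
  have hxn : ‖x‖ ≤ θ * ‖avg w - wstar‖ := by
    have := hT (avg w) wstar
    rwa [hf0, smul_zero, sub_zero] at this
  -- A convex combination with weights `θ` and `1 - θ = η μ / 2`: the first point is no longer than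
  -- the old mean error, the second is the gradient discrepancy rescaled by `2 / μ`, at most `2 κ`
  -- times the distances to the mean.
  have hdec : avg (fun p => w p - η • f (w p)) - wstar
      = θ • (θ⁻¹ • x) + (η * μ / 2) • ((-(2 / μ)) • δ) := by
    rw [smul_smul, mul_inv_cancel₀ hθ0.ne', one_smul, smul_smul, hx, hδ, avg_sub, avg_smul,
      avg_sub, avg_const, show η * μ / 2 * -(2 / μ) = -η by field_simp]
    module
  have h1 : ψ (θ⁻¹ • x) ≤ ψ (avg w - wstar) := by
    refine hψ.mono _ _ ?_
    rw [norm_smul, norm_inv, Real.norm_of_nonneg hθ0.le, ← div_eq_inv_mul, div_le_iff₀ hθ0,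
      mul_comm]
    exact hxn
  have h2 : ψ ((-(2 / μ)) • δ) ≤ 4 * κ ^ 2 * spread ψ w := by
    rw [hδ, ← avg_smul]
    refine (convexOn_map_avg_le hψ.convexOn _).trans ?_
    calc avg (fun p => ψ ((-(2 / μ)) • (f (w p) - f (avg w))))
        ≤ avg (fun p => 4 * κ ^ 2 * ψ (w p - avg w)) := avg_mono fun p => by
          refine le_trans (hψ.mono _ ((2 * κ) • (w p - avg w)) ?_)
            ((hψ.scale (2 * κ) _ (by linarith)).trans_eq (by ring))
          rw [norm_smul, norm_smul, norm_neg, Real.norm_of_nonneg (by positivity),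
            Real.norm_of_nonneg (by positivity), div_mul_eq_mul_div, div_le_iff₀ hμ]
          calc 2 * ‖f (w p) - f (avg w)‖ ≤ 2 * (κ * μ * ‖w p - avg w‖) := by
                gcongr
                exact (hfL _ _).trans (by gcongr)
            _ = _ := by ring
      _ = 4 * κ ^ 2 * avg (fun p => ψ (w p - avg w)) := avg_mul _ _
      _ ≤ _ := by gcongr; exact hψ.avg_sub_avg_le w
  rw [hdec]
  refine (hψ.convexOn.2 (Set.mem_univ _) (Set.mem_univ _) hθ0.le (by positivity)
    (by rw [hθ]; ring)).trans ?_
  calc θ • ψ (θ⁻¹ • x) + (η * μ / 2) • ψ ((-(2 / μ)) • δ)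
      ≤ θ * ψ (avg w - wstar) + (η * μ / 2) * (4 * κ ^ 2 * spread ψ w) := by
        simp only [smul_eq_mul]; gcongr
    _ = _ := by ring

variable {Ω : Type*} [MeasurableSpace Ω] {Pr : Measure Ω} [IsProbabilityMeasure Pr]
  {ξ : Fin P → Ω → Vec d} {σ : ℝ}

lemma Gauge.meanLE_mean (hψ : Gauge ψ m) (hξ : Noise Pr ξ fun _ => σ ^ 2) (a : Fin P → Vec d)
    (wstar : Vec d) (η : ℝ) :
    MeanLE Pr (fun ω => ψ (avg (fun p => a p + (-η) • ξ p ω) - wstar))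
      (ψ (avg a - wstar) + m * (η ^ 2 * σ ^ 2 / P)) := by
  refine (hξ.meanLE_avg hψ (avg a - wstar) (-η)).mono (fun ω => ?_) (le_of_eq ?_)
  · rw [avg_add, avg_smul, add_sub_right_comm]
  · rw [avg_const]; ring

/-- Differences of two machines gain no factor `1 / P`; it is regained in `Gauge.meanLE_lyapunov`
from the shortness of the phases. -/
lemma Gauge.meanLE_spread (hψ : Gauge ψ m) (hξ : Noise Pr ξ fun _ => σ ^ 2) (a : Fin P → Vec d)
    (η : ℝ) :
    MeanLE Pr (fun ω => spread ψ fun p => a p + (-η) • ξ p ω)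
      (spread ψ a + 4 * m * (η ^ 2 * σ ^ 2)) := by
  refine (MeanLE.avg fun p => MeanLE.avg fun q =>
    hξ.meanLE_sub hψ (a p - a q) (-η) p q).mono (fun ω => ?_) (le_of_eq ?_)
  · refine avg_mono fun p => avg_mono fun q => le_of_eq ?_
    congr 1
    module
  · simp only [avg_add, avg_const, spread]
    ring

/-- One step decreases the Lyapunov function by the deviation, up to the noise level. -/
lemma Gauge.meanLE_lyapunov (hψ : Gauge ψ m) (hμ : 0 < μ) (hη : 0 < η) (hημ : η * μ ≤ 1)
    (hκ : 1 ≤ κ) (hLκ : L ≤ κ * μ) (hf0 : f wstar = 0)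
    (hT : ∀ x y, ‖(x - η • f x) - (y - η • f y)‖ ≤ (1 - η * μ / 2) * ‖x - y‖)
    (hfL : ∀ x y, ‖f x - f y‖ ≤ L * ‖x - y‖) (hξ : Noise Pr ξ fun _ => σ ^ 2)
    (w : Fin P → Vec d) {n : ℕ} (hn : n * (μ * η * P) ≤ 1) :
    MeanLE Pr (fun ω => lyapunov ψ wstar (2 / (η * μ)) (1 + 4 * κ ^ 2) n
        fun p => (w p - η • f (w p)) + (-η) • ξ p ω)
      (lyapunov ψ wstar (2 / (η * μ)) (1 + 4 * κ ^ 2) (n + 1) w - deviation ψ wstar w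
        + m * ((6 + 16 * κ ^ 2) * η * σ ^ 2 / (μ * P))) := by
  have hP : (0 : ℝ) < P := Nat.cast_pos.mpr (NeZero.pos P)
  have hημ0 : 0 < η * μ := mul_pos hη hμ
  have h1 := (hψ.meanLE_mean hξ (fun p => w p - η • f (w p)) wstar η).const_mul
    (show 0 ≤ 2 / (η * μ) by positivity)
  have h2 := (hψ.meanLE_spread hξ (fun p => w p - η • f (w p)) η).const_mul
    (show 0 ≤ (1 + 4 * κ ^ 2) * n by positivity)
  refine (h1.add h2).mono (fun ω => le_rfl) ?_
  have h3 := hψ.mean_step_le hμ hη hημ hκ hLκ hf0 hT hfL w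
  have h4 : spread ψ (fun p => w p - η • f (w p)) ≤ spread ψ w := by
    refine avg_mono fun p => avg_mono fun q => hψ.mono _ _ ((hT _ _).trans ?_)
    exact mul_le_of_le_one_left (norm_nonneg _) (by linarith)
  -- The restriction on the phase length enters here: it bounds the weight of the spread noise by
  -- the mini-batch scale `1 / (μ P)`.
  have h5 : n * η ≤ 1 / (μ * P) := by
    rw [le_div_iff₀ (by positivity)]; linarith
  have hD := hψ.spread_nonneg w
  have hm := hψ.nonneg_const
  set B := ψ (avg w - wstar)
  set D := spread ψ w
  -- The weight `2 / (η μ)` makes the contraction release exactly `B`, at the cost of `4 κ² D`. The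
  -- unit of `(1 + 4 κ²) D` released by the counter pays for this and leaves `D`.
  have h6 : 2 / (η * μ) * (ψ (avg (fun p => w p - η • f (w p)) - wstar)
        + m * (η ^ 2 * σ ^ 2 / P))
      ≤ 2 / (η * μ) * B - B + 4 * κ ^ 2 * D + m * (2 * η * σ ^ 2 / (μ * P)) := by
    calc _ ≤ 2 / (η * μ) * ((1 - η * μ / 2) * B + 2 * κ ^ 2 * (η * μ) * D
          + m * (η ^ 2 * σ ^ 2 / P)) := by gcongr
      _ = _ := by field_simp; ring
  have h7 : (1 + 4 * κ ^ 2) * n * (spread ψ (fun p => w p - η • f (w p))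
        + 4 * m * (η ^ 2 * σ ^ 2))
      ≤ (1 + 4 * κ ^ 2) * n * D + m * ((4 + 16 * κ ^ 2) * η * σ ^ 2 / (μ * P)) := by
    calc _ ≤ (1 + 4 * κ ^ 2) * n * (D + 4 * m * (η ^ 2 * σ ^ 2)) := by gcongr
      _ = (1 + 4 * κ ^ 2) * n * D + (4 + 16 * κ ^ 2) * m * (η * σ ^ 2) * (n * η) := by ring
      _ ≤ (1 + 4 * κ ^ 2) * n * D + (4 + 16 * κ ^ 2) * m * (η * σ ^ 2) * (1 / (μ * P)) := by
        gcongr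
      _ = _ := by field_simp
  refine (add_le_add h6 h7).trans (le_of_eq ?_)
  rw [lyapunov, deviation]
  push_cast
  field_simp
  ring

lemma Gauge.lyapunov_le_deviation (hψ : Gauge ψ m) (hημ0 : 0 < η * μ) (wstar : Vec d)
    (w : Fin P → Vec d) {n : ℕ} (hn : n * (μ * η * P) ≤ 1) :
    lyapunov ψ wstar (2 / (η * μ)) (1 + 4 * κ ^ 2) n w
      ≤ (3 + 4 * κ ^ 2) / (η * μ) * deviation ψ wstar w := by
  have hP : (1 : ℝ) ≤ P := by exact_mod_cast NeZero.one_le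
  have hn' : (n : ℝ) ≤ 1 / (η * μ) := by
    rw [le_div_iff₀ hημ0]
    refine le_trans ?_ hn
    have : (n : ℝ) * (η * μ) * 1 ≤ n * (η * μ) * P := by gcongr
    linarith
  have hB := hψ.nonneg (avg w - wstar)
  have hD := hψ.spread_nonneg w
  rw [lyapunov, deviation, mul_add]
  refine add_le_add ?_ ?_
  · gcongr; nlinarith [sq_nonneg κ]
  · calc (1 + 4 * κ ^ 2) * n * spread ψ w ≤ (3 + 4 * κ ^ 2) * (1 / (η * μ)) * spread ψ w := by
          gcongr; linarith
      _ = _ := by ring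

end Dispersion

/-! ### The strongly convex case -/

section StronglyConvex

/-- The potential which controls the square of the accumulated deviations: `S` is the accumulated
deviation, `Y₁` and `Y₂` are Lyapunov functions for two gauges with increments `c₁` and `c₂`, `R` is
the number of remaining steps and `X` the total number of steps. -/
def accPotential (c₁ c₂ K X R S Y₁ Y₂ : ℝ) : ℝ :=
  S ^ 2 + 2 * S * Y₁ + 2 * c₁ * R * (S + Y₁) + 2 * c₁ ^ 2 * X * R + K * (Y₂ + c₂ * R)

/-- `Y₁ + c₁ R` bounds the mean of the deviations still to come. Expanding the square, the cross
term `2 U Y₁` is paid for by the decrease of `K Y₂`, the drift `2 c₁ (S + U)` by the lost unit of `2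
c₁ R (S + Y₁)`, and `2 c₁² R` by that of `2 c₁² X R`. -/
lemma accPotential_step {c₁ c₂ K X R S U Y₁ Y₂ U₂ : ℝ} (hc₁ : 0 ≤ c₁) (hUY : U ≤ Y₁)
    (hRX : R ≤ X) (hK : 2 * U * Y₁ ≤ K * U₂) :
    (S + U) ^ 2 + 2 * c₁ * R * (S + U) + 2 * c₁ ^ 2 * X * R + K * (c₂ * R)
        + (2 * (S + U) + 2 * c₁ * R) * (Y₁ - U + c₁) + K * (Y₂ - U₂ + c₂)
      ≤ accPotential c₁ c₂ K X (R + 1) S Y₁ Y₂ := by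
  have h1 := mul_le_mul_of_nonneg_left hUY hc₁
  have h2 := mul_le_mul_of_nonneg_left hRX (sq_nonneg c₁)
  unfold accPotential
  nlinarith [sq_nonneg U]

/-- The potential is affine in the two Lyapunov values with nonnegative coefficients, so bounds on
their means can be inserted. -/
lemma MeanLE.accPotential {Ω : Type*} [MeasurableSpace Ω] {Pr : Measure Ω}
    [IsProbabilityMeasure Pr] {c₁ c₂ K X R S U Y₁ Y₂ U₂ : ℝ} {f₁ f₂ : Ω → ℝ} {S' : ℝ}
    (h₁ : MeanLE Pr f₁ (Y₁ - U + c₁)) (h₂ : MeanLE Pr f₂ (Y₂ - U₂ + c₂))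
    (hf₁ : ∀ ω, 0 ≤ f₁ ω) (hc₁ : 0 ≤ c₁) (hS : 0 ≤ S) (hU : 0 ≤ U) (hUY : U ≤ Y₁)
    (hR : 0 ≤ R) (hRX : R ≤ X) (hK0 : 0 ≤ K) (hK : 2 * U * Y₁ ≤ K * U₂) (hS0 : 0 ≤ S')
    (hS' : S' ≤ S + U) :
    MeanLE Pr (fun ω => accPotential c₁ c₂ K X R S' (f₁ ω) (f₂ ω))
      (accPotential c₁ c₂ K X (R + 1) S Y₁ Y₂) := by
  have h3 := ((MeanLE.const (Pr := Pr) ((S + U) ^ 2 + 2 * c₁ * R * (S + U) + 2 * c₁ ^ 2 * X * R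
    + K * (c₂ * R))).add (h₁.const_mul (show 0 ≤ 2 * (S + U) + 2 * c₁ * R by positivity))).add
    (h₂.const_mul hK0)
  refine h3.mono (fun ω => ?_) (accPotential_step hc₁ hUY hRX hK)
  have h4 := hf₁ ω
  calc LocalSGD.accPotential c₁ c₂ K X R S' (f₁ ω) (f₂ ω)
      ≤ LocalSGD.accPotential c₁ c₂ K X R (S + U) (f₁ ω) (f₂ ω) := by
        unfold LocalSGD.accPotential; gcongr
    _ = _ := by unfold LocalSGD.accPotential; ring

lemma accPotential_nonneg {c₁ c₂ K X R S Y₁ Y₂ : ℝ} (hc₁ : 0 ≤ c₁) (hc₂ : 0 ≤ c₂) (hK : 0 ≤ K)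
    (hX : 0 ≤ X) (hR : 0 ≤ R) (hS : 0 ≤ S) (hY₁ : 0 ≤ Y₁) (hY₂ : 0 ≤ Y₂) :
    0 ≤ accPotential c₁ c₂ K X R S Y₁ Y₂ := by unfold accPotential; positivity

variable {d P C : ℕ} {N : ℕ → ℕ} {Ω Ξ : Type*} [mΩ : MeasurableSpace Ω] [MeasurableSpace Ξ]
  {Pr : Measure Ω} {F : Vec d → ℝ} {wstar w₀ : Vec d}
  {G : Ξ → Vec d → Vec d} {Z : ℕ → ℕ → Fin P → Ω → Ξ} {μ L M η σ κ : ℝ}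

/-- The constant of the strongly convex case. -/
def rateConst (κ : ℝ) : ℝ :=
  4 * (2 + (3 + 8 * κ ^ 2) + 1 + 144 * (3 * (3 + 8 * κ ^ 2) ^ 2 + 1
    + 2 * (4 * (3 + 4 * κ ^ 2)) * κ ^ 2 + (4 * (3 + 4 * κ ^ 2)) * (6 + 16 * κ ^ 2) * κ ^ 2))

lemma rateConst_nonneg (κ : ℝ) : 0 ≤ rateConst κ := by unfold rateConst; positivity

/-- The difference of the two sides is linear in `a`, `b`, `u`, `v` with nonnegative coefficients.
-/
lemma rate_arith {a b u v g D k : ℝ} (ha : 0 ≤ a) (hb : 0 ≤ b) (hu : 0 ≤ u) (hv : 0 ≤ v)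
    (hg : 0 ≤ g) (hD : 0 ≤ D) (hk : 0 ≤ k) :
    4 * (2 * a + g * b + b) + 576 * (3 * g ^ 2 * u + v + k * (2 * D * a + D * (2 * g) * b))
      ≤ 4 * (2 + g + 1 + 144 * (3 * g ^ 2 + 1 + 2 * D * k + D * (2 * g) * k))
        * (a + v + (b + u)) := by
  set p := 3 * g ^ 2 with hp
  set q := 2 * D * k with hq
  set s := D * (2 * g) * k with hs
  have hp0 : 0 ≤ p := by positivity
  have hq0 : 0 ≤ q := by positivity
  have hs0 : 0 ≤ s := by positivity
  have e : 4 * (2 + g + 1 + 144 * (p + 1 + q + s)) * (a + v + (b + u))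
      - (4 * (2 * a + g * b + b) + 576 * (p * u + v + k * (2 * D * a + D * (2 * g) * b)))
      = a * (4 * g + 4 + 576 * (p + 1 + s)) + v * (4 * (2 + g + 1) + 576 * (p + q + s))
        + b * (8 + 576 * (p + 1 + q)) + u * (4 * (2 + g + 1) + 576 * (1 + q + s)) := by
    rw [hq, hs]; ring
  have : 0 ≤ a * (4 * g + 4 + 576 * (p + 1 + s)) + v * (4 * (2 + g + 1) + 576 * (p + q + s))
        + b * (8 + 576 * (p + 1 + q)) + u * (4 * (2 + g + 1) + 576 * (1 + q + s)) := by positivity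
  linarith

/-- The bounds on the final error, the accumulated noise and the accumulated deviations add up to
the mini-batch rate. -/
lemma total_le_rate {r X Pn B : ℝ} (hX : 0 < X) (hP : 0 < Pn) (hμ : 0 < μ) (hL : 0 < L)
    (hη : 0 < η) (hM : 0 < M) (hLκ : L ≤ κ * μ)
    (hB : B ≤ 1 / (2 * (L / M)) * r ^ 2) {c₁ c₂ Kc : ℝ}
    (hc₁ : c₁ = 1 / (2 * (L / M)) * ((6 + 16 * κ ^ 2) * η * σ ^ 2 / (μ * Pn)))
    (hc₂ : c₂ = (6 + 16 * κ ^ 2) * η * σ ^ 2 / (μ * Pn))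
    (hKc : Kc = 4 * (3 + 4 * κ ^ 2) / (η * μ)) :
    4 / X ^ 2 * (r ^ 2 / η ^ 2 + (r ^ 2 + η * μ / 2 * (X * c₂)) / η ^ 2 + X * (σ ^ 2 / Pn)
      + (12 * L) ^ 2 * accPotential c₁ c₂ Kc X X 0 (2 / (η * μ) * B) (2 / (η * μ) * r ^ 2))
    ≤ rateConst κ * (r ^ 2 / (η ^ 2 * X ^ 2) * (1 + M ^ 2 / μ ^ 2 * r ^ 2)
      + σ ^ 2 / (Pn * X) * (1 + (M ^ 2 * X * Pn * η ^ 2 * σ ^ 2 / μ ^ 2) / Pn ^ 2)) := by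
  set g : ℝ := 3 + 8 * κ ^ 2 with hg
  have hg0 : 0 < g := by positivity
  set D : ℝ := 4 * (3 + 4 * κ ^ 2) with hD
  have hD0 : 0 < D := by positivity
  have hg2 : 6 + 16 * κ ^ 2 = 2 * g := by rw [hg]; ring
  set a := r ^ 2 / (η ^ 2 * X ^ 2) with ha
  set b := σ ^ 2 / (Pn * X) with hb
  -- The squares `u ^ 2` and `v ^ 2` are the two terms of the rate containing `M`; the first moment
  -- estimates produce `u` and `v` themselves.
  set u := M * η * σ ^ 2 / (μ * Pn) with hu
  set v := M * r ^ 2 / (η * μ * X) with hv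
  have ha0 : 0 ≤ a := by positivity
  have hb0 : 0 ≤ b := by positivity
  have hu0 : 0 ≤ u := by positivity
  have hv0 : 0 ≤ v := by positivity
  have hL2 : L ^ 2 / μ ^ 2 ≤ κ ^ 2 := by
    rw [div_le_iff₀ (by positivity), ← mul_pow]
    gcongr
  have e1 : a * (1 + M ^ 2 / μ ^ 2 * r ^ 2) = a + v ^ 2 := by
    rw [ha, hv]; field_simp
  have e2 : b * (1 + (M ^ 2 * X * Pn * η ^ 2 * σ ^ 2 / μ ^ 2) / Pn ^ 2) = b + u ^ 2 := by
    rw [hb, hu]; field_simp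
  have hB' : L * (2 / (η * μ) * B) / X ≤ v := by
    calc L * (2 / (η * μ) * B) / X ≤ L * (2 / (η * μ) * (1 / (2 * (L / M)) * r ^ 2)) / X := by
          gcongr
      _ = v := by rw [hv]; field_simp
  have e3 : L * c₁ = g * u := by rw [hc₁, hg2, hu]; field_simp
  have e4 : 1 / X ^ 2 * (L ^ 2 * accPotential c₁ c₂ Kc X X 0 (2 / (η * μ) * B)
        (2 / (η * μ) * r ^ 2))
      = 2 * (L * c₁) * (L * (2 / (η * μ) * B) / X) + 2 * (L * c₁) ^ 2
        + L ^ 2 / μ ^ 2 * (2 * D * a + D * (2 * g) * b) := by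
    rw [accPotential, hKc, hc₂, ha, hb, hg2]; field_simp; ring
  have e5 : 1 / X ^ 2 * (L ^ 2 * accPotential c₁ c₂ Kc X X 0 (2 / (η * μ) * B)
        (2 / (η * μ) * r ^ 2))
      ≤ 3 * g ^ 2 * u ^ 2 + v ^ 2 + κ ^ 2 * (2 * D * a + D * (2 * g) * b) := by
    rw [e4, e3]
    have h1 : 2 * (g * u) * (L * (2 / (η * μ) * B) / X) ≤ 2 * (g * u) * v := by gcongr
    have h2 : L ^ 2 / μ ^ 2 * (2 * D * a + D * (2 * g) * b)
        ≤ κ ^ 2 * (2 * D * a + D * (2 * g) * b) := by gcongr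
    nlinarith [sq_nonneg (g * u - v)]
  have e6 : 1 / X ^ 2 * (r ^ 2 / η ^ 2 + (r ^ 2 + η * μ / 2 * (X * c₂)) / η ^ 2
      + X * (σ ^ 2 / Pn)) = 2 * a + g * b + b := by
    rw [hc₂, ha, hb, hg2]; field_simp; ring
  have hrc : rateConst κ = 4 * (2 + g + 1 + 144 * (3 * g ^ 2 + 1 + 2 * D * κ ^ 2
      + D * (2 * g) * κ ^ 2)) := by rw [rateConst, hg2]
  rw [e1, e2, hrc]
  set V := accPotential c₁ c₂ Kc X X 0 (2 / (η * μ) * B) (2 / (η * μ) * r ^ 2)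
  calc 4 / X ^ 2 * (r ^ 2 / η ^ 2 + (r ^ 2 + η * μ / 2 * (X * c₂)) / η ^ 2 + X * (σ ^ 2 / Pn)
      + (12 * L) ^ 2 * V)
      = 4 * (1 / X ^ 2 * (r ^ 2 / η ^ 2 + (r ^ 2 + η * μ / 2 * (X * c₂)) / η ^ 2
        + X * (σ ^ 2 / Pn))) + 576 * (1 / X ^ 2 * (L ^ 2 * V)) := by ring
    _ ≤ 4 * (2 * a + g * b + b)
        + 576 * (3 * g ^ 2 * u ^ 2 + v ^ 2 + κ ^ 2 * (2 * D * a + D * (2 * g) * b)) := by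
        rw [e6]; gcongr
    _ ≤ _ := rate_arith ha0 hb0 (sq_nonneg u) (sq_nonneg v) hg0.le hD0.le (sq_nonneg κ)

/-- The strongly convex case, in dimension at least one and for `M > 0`. -/
theorem stronglyConvex_bound_of_pos [IsProbabilityMeasure Pr] (hd : 0 < d) (hP : 1 ≤ P)
    (hC : 1 ≤ C) (hN : ∀ t ∈ Finset.Icc 1 C, 1 ≤ N t) (hμ : 0 < μ) (hη : 0 < η)
    (hηL : 2 * η * L ≤ 1) (hκ : L / μ ≤ κ) (hM : 0 < M)
    (hs : StrongConvexOn Set.univ μ F) (hmin : IsMinOn F Set.univ wstar)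
    (hreg : SmoothRegular F L M) (h : GradientOracle Pr F C N G Z)
    (hvar : BoundedVariance Pr F C N G Z σ)
    (hNle : ∀ t ∈ Finset.Icc 1 C, (N t : ℝ) ≤ 1 / (μ * η * P)) :
    Integrable (sqError F wstar w₀ η C N G Z) Pr ∧
      ∫ ω, sqError F wstar w₀ η C N G Z ω ∂Pr
        ≤ rateConst κ * miniBatchRate μ L M η σ ‖w₀ - wstar‖ P (totalSteps N C) := by
  have : NeZero P := ⟨by omega⟩
  have hP0 : (0 : ℝ) < P := Nat.cast_pos.mpr hP
  have hN1 : 0 < N (0 + 1) := hN 1 (by simp [hC])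
  have hX : 0 < totalSteps N C := lt_of_lt_of_le (by rw [totalSteps_succ]; omega)
    (totalSteps_mono N hC : totalSteps N (0 + 1) ≤ totalSteps N C)
  have hX0 : (0 : ℝ) < totalSteps N C := Nat.cast_pos.mpr hX
  set H := hess F wstar with hHdef
  have hge := hreg.hess_inner_ge hs wstar
  -- Tested on a unit vector, hence the need for positive dimension.
  have hμL : μ ≤ L := by
    have h1 := hge (EuclideanSpace.single ⟨0, hd⟩ 1)
    have h2 := real_inner_le_norm (H (EuclideanSpace.single ⟨0, hd⟩ 1))
      (EuclideanSpace.single ⟨0, hd⟩ (1 : ℝ))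
    have h3 := H.le_of_opNorm_le (hreg.norm_hess_le wstar)
      (EuclideanSpace.single ⟨0, hd⟩ (1 : ℝ))
    have h4 : ‖EuclideanSpace.single (⟨0, hd⟩ : Fin d) (1 : ℝ)‖ = 1 := by simp
    rw [h4] at h1 h2 h3
    linarith
  have hL : 0 < L := hμ.trans_le hμL
  have hLκ : L ≤ κ * μ := (div_le_iff₀ hμ).mp hκ
  have hκ1 : 1 ≤ κ := le_of_mul_le_mul_right (by linarith) hμ
  have hημ0 : 0 < η * μ := mul_pos hη hμ
  have hημ : η * μ ≤ 1 := by nlinarith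
  set f : Vec d → Vec d := gradient F with hf
  have hf0 : f wstar = 0 := gradient_eq_zero_of_isMinOn hmin
  have hfm : Measurable f := hreg.contDiff_gradient.continuous.measurable
  have hT := hreg.gradient_step_lipschitz hs hμ.le hη.le hηL hημ
  have hfL := hreg.gradient_lipschitz
  have hH : ∀ v, ‖v - η • H v‖ ≤ ‖v‖ := fun v =>
    (norm_sub_smul_le (cocoercive_of_symm (hreg.hess_symm wstar)
      (fun v => le_trans (by positivity) (hge v)) (hreg.norm_hess_le wstar)) hge hμ.le hη.le hηL
      hημ v).trans (mul_le_of_le_one_left (norm_nonneg v) (by linarith))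
  -- The radius at which `M ‖e‖²` and `L ‖e‖` agree.
  have ha : 0 < L / M := by positivity
  set ψ : Vec d → ℝ := huber (L / M) with hψdef
  set m : ℝ := 1 / (2 * (L / M)) with hm
  have hψ : Gauge ψ m := gauge_huber ha
  set U : (Fin P → Vec d) → ℝ := deviation ψ wstar with hU
  set α : ℝ := 2 / (η * μ) with hα
  have hα0 : 0 ≤ α := by positivity
  set γ : ℝ := 1 + 4 * κ ^ 2 with hγ
  have hγ0 : 0 ≤ γ := by positivity
  set c₂ : ℝ := (6 + 16 * κ ^ 2) * η * σ ^ 2 / (μ * P) with hc₂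
  have hc₂0 : 0 ≤ c₂ := by positivity
  set c₁ : ℝ := m * c₂ with hc₁
  have hc₁0 : 0 ≤ c₁ := by positivity
  set Kc : ℝ := 4 * (3 + 4 * κ ^ 2) / (η * μ) with hKc
  have hKc0 : 0 ≤ Kc := by positivity
  set r : ℝ := ‖w₀ - wstar‖ with hr
  set sq : Vec d → ℝ := fun x => ‖x‖ ^ 2 with hsq
  have hsqg : Gauge sq 1 := gauge_norm_sq
  set step := sgdStep (P := P) η f U wstar G with hstepdef
  have hstepm : Measurable (Function.uncurry step) :=
    measurable_sgdStep η hfm (hψ.measurable_deviation wstar) wstar h.measurable_field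
  have hnoise : ∀ t k (_ : t < C) (_ : k < N (t + 1)) (w : Fin P → Vec d),
      Noise Pr (fun p ω => G (Z (t + 1) (k + 1) p ω) (w p) - f (w p)) fun _ => σ ^ 2 :=
    fun t k ht hk w => h.noise ht hk w fun p => hvar _ _
  have hstate : ∀ (s : State d P) z, (step s z).1 = fun p =>
      (s.1 p - η • f (s.1 p)) + (-η) • (G (z p) (s.1 p) - f (s.1 p)) := by
    intro s z
    funext p
    simp only [hstepdef, sgdStep]
    module
  have hn : ∀ t n : ℕ, t < C → n < N (t + 1) → ((n + 1 : ℕ) : ℝ) * (μ * η * P) ≤ 1 := by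
    intro t n ht hn
    have h1 := hNle (t + 1) (by simp only [Finset.mem_Icc]; omega)
    rw [le_div_iff₀ (by positivity)] at h1
    refine le_trans ?_ h1
    gcongr
    omega
  have hn' : ∀ t n : ℕ, t < C → n < N (t + 1) → (n : ℝ) * (μ * η * P) ≤ 1 := by
    intro t n ht hnt
    refine le_trans ?_ (hn t n ht hnt)
    gcongr
    omega
  have hY₁ : ∀ t k n (_ : t < C) (_ : k < N (t + 1)) (_ : n < N (t + 1)) (s : State d P),
      MeanLE Pr (fun ω => lyapunov ψ wstar α γ n (step s fun p => Z (t + 1) (k + 1) p ω).1)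
        (lyapunov ψ wstar α γ (n + 1) s.1 - U s.1 + c₁) := by
    intro t k n ht hk hnt s
    simp only [hstate]
    exact hψ.meanLE_lyapunov hμ hη hημ hκ1 hLκ hf0 hT hfL (hnoise t k ht hk s.1) s.1
      (hn' t n ht hnt)
  have hY₂ : ∀ t k n (_ : t < C) (_ : k < N (t + 1)) (_ : n < N (t + 1)) (s : State d P),
      MeanLE Pr (fun ω => lyapunov sq wstar α γ n (step s fun p => Z (t + 1) (k + 1) p ω).1)
        (lyapunov sq wstar α γ (n + 1) s.1 - deviation sq wstar s.1 + c₂) := by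
    intro t k n ht hk hnt s
    simp only [hstate]
    refine (hsqg.meanLE_lyapunov hμ hη hημ hκ1 hLκ hf0 hT hfL (hnoise t k ht hk s.1) s.1
      (hn' t n ht hnt)).mono (fun _ => le_rfl) ?_
    rw [one_mul]
  have hsync : ∀ {ψ' : Vec d → ℝ} {m' : ℝ} (_ : Gauge ψ' m') (n : ℕ) (s : State d P),
      lyapunov ψ' wstar α γ n (sgdSync s).1 = lyapunov ψ' wstar α γ 0 s.1 := by
    intro ψ' m' hg n s
    simp only [sgdSync]
    rw [hg.lyapunov_const, lyapunov]
    simp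
  have hlm₁ : ∀ n, Measurable fun s : State d P => lyapunov ψ wstar α γ n s.1 := fun n =>
    (hψ.measurable_lyapunov wstar α γ n).comp measurable_fst
  have hlm₂ : ∀ n, Measurable fun s : State d P => lyapunov sq wstar α γ n s.1 := fun n =>
    (hsqg.measurable_lyapunov wstar α γ n).comp measurable_fst
  -- The factor `η μ / 2` normalises the weight of the squared mean error to one.
  have B₁ := lintegral_chainSync_le hstepm measurable_sgdSync h.adaptedInputs
    (V := fun R n s => η * μ / 2 * (lyapunov sq wstar α γ n s.1 + R * c₂))
    (s := (fun _ => w₀, 0, 0, 0)) (v := r ^ 2 + η * μ / 2 * (totalSteps N C * c₂))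
    (fun R n => ((hlm₂ n).add_const _).const_mul _)
    (fun R n s => by
      have := hsqg.lyapunov_nonneg wstar hα0 hγ0 n s.1
      positivity)
    (fun n => by
      rw [hsqg.lyapunov_const, mul_add, ← mul_assoc, hα]
      refine le_of_eq ?_
      rw [show η * μ / 2 * (2 / (η * μ)) = 1 by field_simp, one_mul])
    (fun R n s => by rw [hsync hsqg])
    (fun t k R n ht hk hnt _ s => by
      refine (((hY₂ t k n ht hk hnt s).add (MeanLE.const (R * c₂))).const_mul
        (show 0 ≤ η * μ / 2 by positivity)).mono (fun _ => le_rfl) ?_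
      refine mul_le_mul_of_nonneg_left ?_ (by positivity)
      have := hsqg.deviation_nonneg wstar s.1
      push_cast
      linarith)
  have B₂ := lintegral_chainSync_le hstepm measurable_sgdSync h.adaptedInputs
    (V := fun R _ s => ‖s.2.2.1‖ ^ 2 + R * (σ ^ 2 / P))
    (s := (fun _ => w₀, 0, 0, 0)) (v := totalSteps N C * (σ ^ 2 / P))
    (fun R n => by fun_prop) (fun R n s => by positivity) (fun n => by simp)
    (fun R n s => le_rfl)
    (fun t k R n ht hk _ _ s => by
      have hq := ((hnoise t k ht hk s.1).meanLE_avg gauge_norm_sq s.2.2.1 1).add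
        (MeanLE.const (R * (σ ^ 2 / P)))
      refine hq.mono (fun ω => ?_) (le_of_eq ?_)
      · simp only [hstepdef, sgdStep, one_smul]; exact le_rfl
      · rw [avg_const]; push_cast; ring)
  -- The absolute value keeps the potential nonnegative at every state, including those with a
  -- negative accumulator.
  have B₃ := lintegral_chainSync_le hstepm measurable_sgdSync h.adaptedInputs
    (V := fun R n s => accPotential c₁ c₂ Kc (totalSteps N C) R |s.2.2.2|
      (lyapunov ψ wstar α γ n s.1) (lyapunov sq wstar α γ n s.1))
    (s := (fun _ => w₀, 0, 0, 0))
    (v := accPotential c₁ c₂ Kc (totalSteps N C) (totalSteps N C) 0 (α * ψ (w₀ - wstar))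
      (α * r ^ 2))
    (fun R n => by
      have h1 := hlm₁ n
      have h2 := hlm₂ n
      have h3 : Measurable fun s : State d P => |s.2.2.2| := by fun_prop
      unfold accPotential
      fun_prop)
    (fun R n s => accPotential_nonneg hc₁0 hc₂0 hKc0 hX0.le (Nat.cast_nonneg R) (abs_nonneg _)
      (hψ.lyapunov_nonneg wstar hα0 hγ0 n s.1) (hsqg.lyapunov_nonneg wstar hα0 hγ0 n s.1))
    (fun n => by rw [hψ.lyapunov_const, hsqg.lyapunov_const, abs_zero])
    (fun R n s => by rw [hsync hψ, hsync hsqg]; exact le_rfl)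
    (fun t k R n ht hk hnt hR s => by
      have hU0 := hψ.deviation_nonneg wstar s.1
      have hacc := MeanLE.accPotential (K := Kc) (X := totalSteps N C) (R := R)
        (S := |s.2.2.2|) (S' := |s.2.2.2 + U s.1|) (hY₁ t k n ht hk hnt s) (hY₂ t k n ht hk hnt s)
        (fun ω => hψ.lyapunov_nonneg wstar hα0 hγ0 n _) hc₁0 (abs_nonneg _) hU0
        (hψ.deviation_le_lyapunov hημ0 hημ wstar s.1 n) (Nat.cast_nonneg R)
        (by exact_mod_cast hR.le) hKc0 ?_ (abs_nonneg _)
        ((abs_add_le _ _).trans_eq (by rw [abs_of_nonneg hU0]))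
      · refine hacc.mono (fun ω => le_rfl) (le_of_eq ?_)
        push_cast
        rfl
      -- Here `Y₁` is at most `(3 + 4 κ²) / (η μ)` times `U`, and `U²` at most twice the quadratic
      -- deviation; this fixes `Kc`.
      · have h1 := hψ.lyapunov_le_deviation (κ := κ) hημ0 wstar s.1 (hn t n ht hnt)
        have h2 := hψ.deviation_sq_le (huber_le_norm ha) wstar s.1
        calc 2 * U s.1 * lyapunov ψ wstar α γ (n + 1) s.1
            ≤ 2 * U s.1 * ((3 + 4 * κ ^ 2) / (η * μ) * U s.1) := by gcongr
          _ = 2 * (3 + 4 * κ ^ 2) / (η * μ) * U s.1 ^ 2 := by ring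
          _ ≤ 2 * (3 + 4 * κ ^ 2) / (η * μ) * (2 * deviation sq wstar s.1) := by gcongr
          _ = _ := by rw [hKc]; ring)
  -- For one machine, `le_huber` applied to the residual divided by `2 M` gives `2 M * 3 (L / M) = 6
  -- L`; passing from the machines to the deviation doubles it.
  have hcurv : ∀ w : Fin P → Vec d,
      ‖H (avg w - wstar) - avg (fun p => f (w p))‖ ≤ 12 * L * U w := by
    intro w
    have h3 := map_avg (H : Vec d →ₗ[ℝ] Vec d) fun p => w p - wstar
    simp only [ContinuousLinearMap.coe_coe] at h3
    rw [← avg_sub_const, h3, ← avg_sub]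
    calc ‖avg fun p => H (w p - wstar) - f (w p)‖
        ≤ avg (fun p => ‖H (w p - wstar) - f (w p)‖) := norm_avg_le _
      _ ≤ avg (fun p => 6 * L * ψ (w p - wstar)) := avg_mono fun p => by
          have h1 := hreg.norm_remainder_le hmin (w p)
          have h2 := hreg.norm_remainder_le' hmin (w p)
          have h4 := le_huber ha (w p - wstar)
            (y := ‖H (w p - wstar) - f (w p)‖ / (2 * M)) (by
              rw [div_le_iff₀ (by positivity)]
              nlinarith [mul_nonneg hM.le (sq_nonneg ‖w p - wstar‖)]) (by
              rw [div_le_iff₀ (by positivity)]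
              refine h2.trans_eq ?_
              field_simp)
          rw [div_le_iff₀ (by positivity)] at h4
          refine h4.trans_eq ?_
          rw [hψdef]
          field_simp
          ring
      _ = 6 * L * avg (fun p => ψ (w p - wstar)) := avg_mul _ _
      _ ≤ 6 * L * (2 * U w) := by gcongr; exact hψ.avg_le_deviation wstar w
      _ = _ := by ring
  have hψw := hψ.nonneg (w₀ - wstar)
  have hres := integral_sqError_le (c := 12 * L) hP hX hη hH hHdef.symm hcurv
    (w₀ := w₀) hfm (hψ.measurable_deviation wstar) h.measurable_field h.adaptedInputs
    (b₁ := r ^ 2 + η * μ / 2 * (totalSteps N C * c₂)) (b₂ := totalSteps N C * (σ ^ 2 / P))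
    (b₃ := accPotential c₁ c₂ Kc (totalSteps N C) (totalSteps N C) 0 (α * ψ (w₀ - wstar))
      (α * r ^ 2)) (by positivity) (by positivity)
    (accPotential_nonneg hc₁0 hc₂0 hKc0 hX0.le hX0.le le_rfl (by positivity) (by positivity))
    (le_trans (lintegral_mono fun ω => ENNReal.ofReal_le_ofReal (by
      rw [lyapunov, hα]
      simp only [Nat.cast_zero, zero_mul, mul_zero, add_zero, ← mul_assoc]
      rw [show η * μ / 2 * (2 / (η * μ)) = 1 by field_simp, one_mul])) B₁)
    (le_trans (lintegral_mono fun ω => ENNReal.ofReal_le_ofReal (by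
      simp only [Nat.cast_zero, zero_mul, add_zero]; exact le_rfl)) B₂)
    (le_trans (lintegral_mono fun ω => ENNReal.ofReal_le_ofReal (by
      set s := chainSync step sgdSync N (fun t k p => Z t k p ω)
        ((fun _ => w₀, 0, 0, 0) : State d P) C
      have h1 := hψ.lyapunov_nonneg wstar hα0 hγ0 0 s.1
      have h2 := hsqg.lyapunov_nonneg wstar hα0 hγ0 0 s.1
      rw [accPotential, sq_abs]
      simp only [Nat.cast_zero, mul_zero, zero_mul, add_zero, add_assoc]
      exact le_add_of_nonneg_right (by positivity))) B₃)
  refine ⟨hres.1, hres.2.trans ?_⟩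
  refine (total_le_rate hX0 hP0 hμ hL hη hM hLκ (huber_le_norm_sq ha (w₀ - wstar)) hc₁ hc₂
    hKc).trans (mul_le_mul_of_nonneg_left ?_ (rateConst_nonneg κ))
  exact le_miniBatchRate hμ hη

/-- The strongly convex case. -/
theorem stronglyConvex_bound [IsProbabilityMeasure Pr] (hd : 0 < d) (hP : 1 ≤ P)
    (hC : 1 ≤ C) (hN : ∀ t ∈ Finset.Icc 1 C, 1 ≤ N t) (hμ : 0 < μ) (hη : 0 < η)
    (hηL : 2 * η * L ≤ 1) (hκ : L / μ ≤ κ)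
    (hs : StrongConvexOn Set.univ μ F) (hmin : IsMinOn F Set.univ wstar)
    (hreg : SmoothRegular F L M) (h : GradientOracle Pr F C N G Z)
    (hvar : BoundedVariance Pr F C N G Z σ)
    (hNle : ∀ t ∈ Finset.Icc 1 C, (N t : ℝ) ≤ 1 / (μ * η * P)) :
    Integrable (sqError F wstar w₀ η C N G Z) Pr ∧
      ∫ ω, sqError F wstar w₀ η C N G Z ω ∂Pr
        ≤ rateConst κ * miniBatchRate μ L M η σ ‖w₀ - wstar‖ P (totalSteps N C) := by
  have hM : 0 ≤ M := (norm_nonneg _).trans (hreg.2.2 wstar)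
  -- The radius `L / M` requires `M > 0`. Any larger bound `M'` on the third derivative is
  -- admissible, and the rate is continuous in it.
  have key : ∀ M' > M, Integrable (sqError F wstar w₀ η C N G Z) Pr ∧
      ∫ ω, sqError F wstar w₀ η C N G Z ω ∂Pr
        ≤ rateConst κ * miniBatchRate μ L M' η σ ‖w₀ - wstar‖ P (totalSteps N C) :=
    fun M' hM' => stronglyConvex_bound_of_pos hd hP hC hN hμ hη hηL hκ (hM.trans_lt hM') hs hmin
      ⟨hreg.1, hreg.2.1, fun w => (hreg.2.2 w).trans hM'.le⟩ h hvar hNle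
  refine ⟨(key (M + 1) (by linarith)).1, ?_⟩
  have hcont : Continuous fun M' => rateConst κ *
      miniBatchRate μ L M' η σ ‖w₀ - wstar‖ P (totalSteps N C) := by
    unfold miniBatchRate Qbias Q1var Q2var
    fun_prop
  exact ge_of_tendsto (x := nhdsWithin M (Set.Ioi M)) ((hcont.tendsto M).mono_left nhdsWithin_le_nhds)
    (Filter.eventually_of_mem self_mem_nhdsWithin fun M' hM' => (key M' hM').2)

end StronglyConvex

/-- In dimension zero there is no error. -/
lemma sqError_bound_of_subsingleton {P C : ℕ} {N : ℕ → ℕ} {Ω Ξ : Type*} [MeasurableSpace Ω]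
    {Pr : Measure Ω} {F : Vec 0 → ℝ} {wstar w₀ : Vec 0} {G : Ξ → Vec 0 → Vec 0}
    {Z : ℕ → ℕ → Fin P → Ω → Ξ} {μ L M η σ r K : ℝ} (hμ : 0 < μ) (hη : 0 < η) (hK : 0 ≤ K) (X : ℕ) :
    Integrable (sqError F wstar w₀ η C N G Z) Pr ∧
      ∫ ω, sqError F wstar w₀ η C N G Z ω ∂Pr ≤ K * miniBatchRate μ L M η σ r P X := by
  have h0 : sqError F wstar w₀ η C N G Z = fun _ => 0 := by
    funext ω
    rw [sqError, Subsingleton.elim (hess F wstar _) 0]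
    simp
  rw [h0]
  refine ⟨integrable_zero _ _ _, ?_⟩
  have : 0 ≤ miniBatchRate μ L M η σ r P X := by
    unfold miniBatchRate Qbias Q1var Q2var; positivity
  simpa using mul_nonneg hK this

end LocalSGD

end

theorem mainTheorem1 :
    -- (1) quadratic case
    (∀ A : ℝ, ∃ K : ℝ, ∀ (d P C : ℕ) (N : ℕ → ℕ) (Ω Ξ : Type*)
      [MeasurableSpace Ω] [MeasurableSpace Ξ] (Pr : Measure Ω) [IsProbabilityMeasure Pr]
      (F : LocalSGD.Vec d → ℝ) (S : Matrix (Fin d) (Fin d) ℝ) (wstar w₀ : LocalSGD.Vec d)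
      (G : Ξ → LocalSGD.Vec d → LocalSGD.Vec d) (Z : ℕ → ℕ → Fin P → Ω → Ξ) (μ L η σ : ℝ),
      1 ≤ P → 1 ≤ C → (∀ t ∈ Finset.Icc 1 C, 1 ≤ N t) →
      0 < μ → 0 < η → 2 * η * L ≤ 1 → 0 ≤ σ →
      LocalSGD.IsQuadratic F wstar S → LocalSGD.SpectrumBetween S μ L →
      LocalSGD.GradientOracle Pr F C N G Z →
      LocalSGD.Cocoercive Pr C N G Z L →
      LocalSGD.FourthMomentAt Pr C N G Z wstar σ →
      (∀ t ∈ Finset.Icc 1 C, (N t : ℝ) ≤ 1 / (μ * η * P)) →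
      (∀ t ∈ Finset.Icc 1 C, μ * η ^ 2 * (LocalSGD.totalSteps N t : ℝ) ≤ A) →
      Integrable (LocalSGD.sqError F wstar w₀ η C N G Z) Pr ∧
      ∫ ω, LocalSGD.sqError F wstar w₀ η C N G Z ω ∂Pr
        ≤ K * LocalSGD.miniBatchRate μ L 0 η σ ‖w₀ - wstar‖ P (LocalSGD.totalSteps N C)) ∧
    -- (2) strongly convex case
    (∀ κ : ℝ, ∃ K : ℝ, ∀ (d P C : ℕ) (N : ℕ → ℕ) (Ω Ξ : Type*)
      [MeasurableSpace Ω] [MeasurableSpace Ξ] (Pr : Measure Ω) [IsProbabilityMeasure Pr]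
      (F : LocalSGD.Vec d → ℝ) (wstar w₀ : LocalSGD.Vec d)
      (G : Ξ → LocalSGD.Vec d → LocalSGD.Vec d) (Z : ℕ → ℕ → Fin P → Ω → Ξ) (μ L M η σ : ℝ),
      1 ≤ P → 1 ≤ C → (∀ t ∈ Finset.Icc 1 C, 1 ≤ N t) →
      0 < μ → 0 < η → 2 * η * L ≤ 1 → 0 ≤ σ → L / μ ≤ κ →
      StrongConvexOn Set.univ μ F → IsMinOn F Set.univ wstar →
      LocalSGD.SmoothRegular F L M →
      LocalSGD.GradientOracle Pr F C N G Z →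
      LocalSGD.BoundedVariance Pr F C N G Z σ →
      (∀ t ∈ Finset.Icc 1 C,
        (N t : ℝ) * (η * P * M *
          ∫ ω, ‖LocalSGD.communicated η N (fun t k p => G (Z t k p ω)) w₀ t - wstar‖ ∂Pr) ≤ 1 ∧
        (N t : ℝ) ≤ 1 / (μ * η * P)) →
      Integrable (LocalSGD.sqError F wstar w₀ η C N G Z) Pr ∧
      ∫ ω, LocalSGD.sqError F wstar w₀ η C N G Z ω ∂Pr
        ≤ K * LocalSGD.miniBatchRate μ L M η σ ‖w₀ - wstar‖ P (LocalSGD.totalSteps N C)) := by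
  refine ⟨fun A => ⟨48, ?_⟩, fun κ => ⟨LocalSGD.rateConst κ, ?_⟩⟩
  · intro d P C N Ω Ξ _ _ Pr _ F S wstar w₀ G Z μ L η σ hP hC hN hμ hη hηL _ hquad hS h hco h4 _ _
    rcases d.eq_zero_or_pos with rfl | hd
    · exact LocalSGD.sqError_bound_of_subsingleton hμ hη (by norm_num) _
    · exact LocalSGD.quadratic_bound hd hP hC hN hμ hη hηL hquad hS h hco h4
  · intro d P C N Ω Ξ _ _ Pr _ F wstar w₀ G Z μ L M η σ hP hC hN hμ hη hηL _ hκ hs hmin hreg h hvar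
      hNle
    rcases d.eq_zero_or_pos with rfl | hd
    · exact LocalSGD.sqError_bound_of_subsingleton hμ hη (LocalSGD.rateConst_nonneg κ) _
    · exact LocalSGD.stronglyConvex_bound hd hP hC hN hμ hη hηL hκ hs hmin hreg h hvar
        fun t ht => (hNle t ht).2
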